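/- Let $A$ be an infinite set, let $\Omega_A=\{-1,1\}^A$ with the product $\sigma$-algebra and the uniform product probability measure $\mathbb P_A$, and let $r_\alpha(\omega)=\omega(\alpha)$ for $\alpha\in A$. For $F\subset A$, let $W_F$ be the set of Walsh characters $w_S=\prod_{\alpha\in S}r_\alpha$, $S\subset F$ finite; the order of $w_S$ is $|S|$, and $\hat f(w)=\int_{\Omega_A} f\,w\,d\mathbb P_A$. For $x\in l^2_{\mathbb R}(F)$ let $Q_F(x)=\operatorname{Im}\mathfrak R_F(ix)\in L^\infty(\Omega_A,\mathbb P_A)$, where the Riesz product $\mathfrak R_F(ix)=\prod_{\alpha\in F}(1+i\,x(\alpha)r_\alpha)$ is the element of $L^\infty(\Omega_A,\mathbb P_A)$ with Walsh series $\sum_{S\subset F,\ |S|<\infty}\big(\prod_{\alpha\in S}i\,x(\alpha)\big)w_S$. There are a partition $\{A_j\}_{j\ge1}$ of $A$ into sets of the same cardinality as $A$, a bijection $\tau_0:A\to A_1$, and bijections $\tau_j:C_j\to A_{j+1}$ ($j\ge1$), where $C_j$ is the set of those $w\in W_{A_j}$ whose order is odd and at least $3$. Fix any such data. There is exactly one $c>0$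 with $2-c^2\sinh(1/c^2)=0$, and $c\approx0.6777$. For $t>c$ put $\sigma_t x=x/(t\|x\|_2)$ if $x\ne0$ and $\sigma_t0=0$. For $x\in l^2_{\mathbb R}(A)$ define $x^{(j)}\in l^2_{\mathbb R}(A_j)$ by $x^{(1)}(\tau_0\alpha)=x(\alpha)$ for $\alpha\in A$, and $$x^{(j+1)}(\tau_j w)=t\,\|x^{(j)}\|_2\,\big(Q_{A_j}(\sigma_t x^{(j)})\big)^\wedge(w),\qquad w\in C_j,\ j\ge1,$$ and let $$\Theta_j(x)=t\,\|x^{(j)}\|_2\,Q_{A_j}(\sigma_t x^{(j)}),\qquad \Phi_2(x;t)=\sum_{j=1}^\infty i^{\,j-1}\,\Theta_j(x),$$ a series that converges absolutely in the $L^\infty$-norm. For $x=u+iv\in l^2(A)$ with $u,v\in l^2_{\mathbb R}(A)$, let $\Theta_j(x)=\Theta_j(u)+i\,\Theta_j(v)$ and $\Phi_2(x;t)=\Phi_2(u;t)+i\,\Phi_2(v;t)$. Let $$K(t)=\frac{t\,e^{1/(2t^2)}}{1-t\sqrt{\sinh(1/t^2)-1/t^2}}.$$ Then, for every $t>c$: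 (1) $\|\Phi_2(x;t)\|_{L^\infty}\le 2K(t)\,\|x\|_2$ for all $x\in l^2(A)$; (2) $\Phi_2(\cdot\,;t)$ is continuous from $l^2(A)$ with the $l^2$-norm to $L^\infty(\Omega_A,\mathbb P_A)$ with the $L^2(\Omega_A,\mathbb P_A)$-norm; (3) for all $x,y\in l^2(A)$, $$\sum_{\alpha\in A}x(\alpha)y(\alpha)=\int_{\Omega_A}\Phi_2(x;t)\,\Phi_2(y;t)\,d\mathbb P_A=\sum_{j=1}^\infty(-1)^{j-1}\sum_{w\in W_{A_j}}\big(\Theta_j(x)\big)^\wedge(w)\,\big(\Theta_j(y)\big)^\wedge(w),$$ where all the sums converge absolutely. (For real $x$, $(\Theta_j(x))^\wedge(w)=t\,\|x^{(j)}\|_2\,(Q_{A_j}(\sigma_tx^{(j)}))^\wedge(w)$.) Moreover, for $t=1$ the map $\Phi_2(x)=\Phi_2(x;1)$ is homogeneous on $l^2_{\mathbb R}(A)$: $\Phi_2(\xi x)=\xi\,\Phi_2(x)$ for all $\xi\in\mathbb C$ and $x\in l^2_{\mathbb R}(A)$. -/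

import Mathlib

open MeasureTheory
open scoped ENNReal

namespace WalshParseval

/-! ### The dyadic group `{-1,1}^A` and its Walsh characters -/

/-- The uniform probability measure on `{-1,1} = ℤˣ`. -/
noncomputable def signMeasure : Measure ℤˣ :=
  (2 : ℝ≥0∞)⁻¹ • (Measure.dirac 1 + Measure.dirac (-1))

instance : IsProbabilityMeasure signMeasure := by
  constructor
  simp only [signMeasure, Measure.smul_apply, Measure.add_apply, measure_univ, smul_eq_mul]
  rw [one_add_one_eq_two, ENNReal.inv_mul_cancel] <;> simp

/-- `Ω_A = {-1,1}^A`. -/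
abbrev Cube (A : Type*) := A → ℤˣ

/-- `ℙ_A`: the uniform product probability measure on `Ω_A`. -/
noncomputable def cubeMeasure (A : Type*) : Measure (Cube A) :=
  Measure.infinitePi fun _ => signMeasure

instance (A : Type*) : IsProbabilityMeasure (cubeMeasure A) := by
  unfold cubeMeasure; infer_instance

/-- The Rademacher character `r_α`, the coordinate function at `α`. -/
def rademacher {A : Type*} (α : A) (ω : Cube A) : ℂ := ((ω α : ℤ) : ℂ)

/-- The Walsh character `∏_{α ∈ S} r_α` of order `|S|`. Every Walsh character is of this form for
exactly one finite set `S`, and sets of Walsh characters are written as sets of finite sets. -/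
def walsh {A : Type*} (S : Finset A) (ω : Cube A) : ℂ := ∏ α ∈ S, rademacher α ω

/-- The Walsh transform `f̂(w_S) = ∫ f w_S dℙ_A`. -/
noncomputable def walshCoeff {A : Type*} (f : Cube A → ℂ) (S : Finset A) : ℂ :=
  ∫ ω, f ω * walsh S ω ∂cubeMeasure A

theorem measurable_of_sign {β : Type*} [MeasurableSpace β] (g : ℤˣ → β) : Measurable g := by
  have h : ∀ s : Set ℤˣ, MeasurableSet s := fun s =>
    ⟨Units.val '' s, MeasurableSpace.measurableSet_top, by
      rw [Set.preimage_image_eq _ Units.val_injective]⟩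
  exact fun s _ => h _

theorem integral_signMeasure (g : ℤˣ → ℂ) :
    ∫ u, g u ∂signMeasure = (g 1 + g (-1)) / 2 := by
  have hi : ∀ a : ℤˣ, Integrable g (Measure.dirac a) := fun a =>
    integrable_dirac' (measurable_of_sign g).stronglyMeasurable (by finiteness)
  have hd : ∀ a : ℤˣ, ∫ u, g u ∂(Measure.dirac a) = g a := fun a =>
    integral_dirac' g a (measurable_of_sign g).stronglyMeasurable
  rw [signMeasure, integral_smul_measure, integral_add_measure (hi _) (hi _), hd, hd]
  simp
  ring

theorem integral_prod_cube {A : Type*} (U : Finset A) (g : A → ℤˣ → ℂ) :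
    ∫ ω, ∏ α ∈ U, g α (ω α) ∂cubeMeasure A = ∏ α ∈ U, ∫ u, g α u ∂signMeasure := by
  have h1 : ∀ ω : Cube A, ∏ α ∈ U, g α (ω α)
      = (fun y : U → ℤˣ => ∏ α : U, g α (y α)) (U.restrict ω) := fun ω => by
    simp only [Finset.restrict]
    exact (Finset.prod_coe_sort U (fun α => g α (ω α))).symm
  rw [integral_congr_ae (Filter.Eventually.of_forall h1), cubeMeasure]
  refine (integral_restrict_infinitePi (μ := fun _ : A => signMeasure)
    (f := fun y : U → ℤˣ => ∏ α : U, g α (y α)) ?_).trans ?_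
  · refine Measurable.aestronglyMeasurable ?_
    exact Finset.measurable_prod _ fun α _ => (measurable_of_sign (g α)).comp (measurable_pi_apply α)
  · rw [integral_fintype_prod_eq_prod (fun α : U => g α)]
    exact Finset.prod_coe_sort U (fun α => ∫ u, g α u ∂signMeasure)

theorem measurable_walsh {A : Type*} (S : Finset A) : Measurable (walsh S) :=
  Finset.measurable_prod _ fun α _ =>
    (measurable_of_sign fun u : ℤˣ => ((u : ℤ) : ℂ)).comp (measurable_pi_apply α)

theorem sign_mul_self (u : ℤˣ) : ((u : ℤ) : ℂ) * ((u : ℤ) : ℂ) = 1 := by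
  rcases Int.units_eq_one_or u with rfl | rfl <;> simp

theorem conj_walsh {A : Type*} (S : Finset A) (ω : Cube A) :
    (starRingEnd ℂ) (walsh S ω) = walsh S ω := by
  simp [walsh, rademacher, map_prod]

theorem norm_walsh {A : Type*} (S : Finset A) (ω : Cube A) : ‖walsh S ω‖ = 1 := by
  rw [walsh, norm_prod]
  refine Finset.prod_eq_one fun α _ => ?_
  rcases Int.units_eq_one_or (ω α) with h | h <;> simp [rademacher, h]

theorem integral_walsh_mul {A : Type*} [DecidableEq A] (S T : Finset A) :
    ∫ ω, walsh S ω * walsh T ω ∂cubeMeasure A = if S = T then 1 else 0 := by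
  classical
  have h1 : ∀ ω : Cube A, walsh S ω * walsh T ω = ∏ α ∈ S ∪ T,
      (fun (α : A) (u : ℤˣ) => (if α ∈ S then ((u : ℤ) : ℂ) else 1) *
        (if α ∈ T then ((u : ℤ) : ℂ) else 1)) α (ω α) := fun ω => by
    rw [Finset.prod_mul_distrib, Finset.prod_ite_mem, Finset.prod_ite_mem]
    simp [walsh, rademacher, Finset.union_inter_cancel_left, Finset.union_inter_cancel_right]
  have h2 := integral_congr_ae (μ := cubeMeasure A) (Filter.Eventually.of_forall h1)
  rw [h2]
  refine (integral_prod_cube (S ∪ T) (fun (α : A) (u : ℤˣ) => (if α ∈ S then ((u : ℤ) : ℂ) else 1) *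
        (if α ∈ T then ((u : ℤ) : ℂ) else 1))).trans ?_
  simp_rw [integral_signMeasure]
  split_ifs with h
  · subst h
    refine Finset.prod_eq_one fun α hα => ?_
    have : α ∈ S := by simpa using hα
    simp [this]
  · obtain ⟨α, hα⟩ : ∃ α, ¬ (α ∈ S ↔ α ∈ T) := by
      by_contra hc
      push Not at hc
      exact h (Finset.ext hc)
    refine Finset.prod_eq_zero (i := α) ?_ ?_
    · rw [Finset.mem_union]; tauto
    · by_cases hS : α ∈ S <;> by_cases hT : α ∈ T <;> simp_all

theorem memLp_walsh {A : Type*} (S : Finset A) (p : ℝ≥0∞) : MemLp (walsh S) p (cubeMeasure A) :=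
  MemLp.of_bound (measurable_walsh S).aestronglyMeasurable 1
    (Filter.Eventually.of_forall fun ω => (norm_walsh S ω).le)

/-- A Walsh character as an element of `L²(Ω_A, ℙ_A)`. -/
noncomputable def walshL2 {A : Type*} (S : Finset A) : Lp ℂ 2 (cubeMeasure A) :=
  (memLp_walsh S 2).toLp

theorem inner_walshL2 {A : Type*} (S : Finset A) (f : Lp ℂ 2 (cubeMeasure A)) :
    inner ℂ (walshL2 S) f = walshCoeff f S := by
  rw [L2.inner_def, walshCoeff]
  refine integral_congr_ae ?_
  filter_upwards [(memLp_walsh S 2).coeFn_toLp] with ω hω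
  rw [walshL2, hω]
  simp [RCLike.inner_apply, conj_walsh]

theorem orthonormal_walshL2 (A : Type*) : Orthonormal ℂ (walshL2 (A := A)) := by
  classical
  rw [orthonormal_iff_ite]
  intro S T
  rw [inner_walshL2, walshCoeff, ← integral_walsh_mul S T]
  refine integral_congr_ae ?_
  filter_upwards [(memLp_walsh T 2).coeFn_toLp] with ω hω
  rw [walshL2, hω, mul_comm]

/-! ### Riesz products -/

/-- The coefficients of the formal Walsh series of the Riesz product `∏_{α ∈ F} (1 + z(α) r_α)`:
the coefficient at `w_S` is `∏_{α ∈ S} z(α)` if `S ⊆ F`, and `0` otherwise. -/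
noncomputable def rieszCoeff {A : Type*} (F : Set A) (z : F → ℂ) (S : Finset A) : ℂ :=
  open Classical in ∏ α ∈ S, if h : α ∈ F then z ⟨α, h⟩ else 0

/-- The Riesz product `ℜ_F(ix)`, `x ∈ l²_ℝ(F)`: the sum in `L²(Ω_A, ℙ_A)` of its Walsh series. -/
noncomputable def rieszL2 {A : Type*} (F : Set A) (x : lp (fun _ : F => ℝ) 2) :
    Lp ℂ 2 (cubeMeasure A) :=
  ∑' S : Finset A, rieszCoeff F (fun α => Complex.I * (x α : ℂ)) S • walshL2 S

open Classical in
/-- Extension by zero of a square summable function on a subset. -/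
theorem summable_sq_extend {A : Type*} (F : Set A) (x : lp (fun _ : F => ℝ) 2) :
    HasSum (fun α : A => if h : α ∈ F then (x ⟨α, h⟩) ^ 2 else 0) (‖x‖ ^ 2) := by
  have h := lp.hasSum_norm (p := 2) (by norm_num) x
  have h2 : HasSum (fun α : F => (x α) ^ 2) (‖x‖ ^ 2) := by
    simpa using h
  have h3 := (Subtype.val_injective (p := fun α => α ∈ F)).hasSum_iff
    (f := fun α : A => if h : α ∈ F then (x ⟨α, h⟩) ^ 2 else 0) (a := ‖x‖ ^ 2) (by
      intro α hα
      have : α ∉ F := by simpa using hα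
      simp [this])
  rw [← h3]
  convert h2 using 2 with α
  simp

open Classical in
theorem norm_rieszCoeff_sq {A : Type*} (F : Set A) (x : lp (fun _ : F => ℝ) 2) (S : Finset A) :
    ‖rieszCoeff F (fun α => Complex.I * (x α : ℂ)) S‖ ^ 2
      = ∏ α ∈ S, if h : α ∈ F then (x ⟨α, h⟩) ^ 2 else 0 := by
  rw [rieszCoeff, norm_prod, ← Finset.prod_pow]
  refine Finset.prod_congr rfl fun α _ => ?_
  split_ifs <;> simp

theorem hasSum_rieszL2 {A : Type*} (F : Set A) (x : lp (fun _ : F => ℝ) 2) :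
    HasSum (fun S : Finset A => rieszCoeff F (fun α => Complex.I * (x α : ℂ)) S • walshL2 S)
      (rieszL2 F x) := by
  classical
  refine Summable.hasSum ?_
  refine ((orthonormal_walshL2 A).orthogonalFamily.summable_iff_norm_sq_summable
    (fun S => rieszCoeff F (fun α => Complex.I * (x α : ℂ)) S)).2 ?_
  simp_rw [norm_rieszCoeff_sq]
  refine summable_finsetProd_of_summable_nonneg (fun α => ?_) (summable_sq_extend F x).summable
  split_ifs
  · positivity
  · exact le_rfl

theorem norm_riesz_partial_le {A : Type*} (F : Set A) (x : lp (fun _ : F => ℝ) 2) (E : Finset A)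
    (ω : Cube A) :
    ‖∑ S ∈ E.powerset, rieszCoeff F (fun α => Complex.I * (x α : ℂ)) S * walsh S ω‖
      ≤ Real.exp (‖x‖ ^ 2 / 2) := by
  classical
  have h1 : ∑ S ∈ E.powerset, rieszCoeff F (fun α => Complex.I * (x α : ℂ)) S * walsh S ω
      = ∏ α ∈ E, (1 + (if h : α ∈ F then Complex.I * (x ⟨α, h⟩ : ℂ) else 0) * rademacher α ω) := by
    rw [Finset.prod_one_add]
    refine Finset.sum_congr rfl fun S _ => ?_
    rw [rieszCoeff, walsh, ← Finset.prod_mul_distrib]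
  rw [h1, norm_prod]
  calc ∏ α ∈ E, ‖1 + (if h : α ∈ F then Complex.I * (x ⟨α, h⟩ : ℂ) else 0) * rademacher α ω‖
      ≤ ∏ α ∈ E, Real.exp ((if h : α ∈ F then (x ⟨α, h⟩) ^ 2 else 0) / 2) := by
        refine Finset.prod_le_prod (fun α _ => norm_nonneg _) fun α _ => ?_
        refine (sq_le_sq₀ (norm_nonneg _) (Real.exp_pos _).le).1 ?_
        rw [← Real.exp_nat_mul, Complex.sq_norm, Complex.normSq_apply]
        refine le_trans (le_of_eq ?_) (Real.add_one_le_exp _)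
        rcases Int.units_eq_one_or (ω α) with hω | hω <;> by_cases h : α ∈ F <;>
          simp [rademacher, hω, h] <;> ring
    _ = Real.exp (∑ α ∈ E, (if h : α ∈ F then (x ⟨α, h⟩) ^ 2 else 0) / 2) :=
        (Real.exp_sum _ _).symm
    _ ≤ Real.exp (‖x‖ ^ 2 / 2) := by
        rw [Real.exp_le_exp, ← Finset.sum_div]
        have := sum_le_hasSum E (fun α _ => by
          split_ifs
          · positivity
          · exact le_rfl) (summable_sq_extend F x)
        linarith

/-- The Riesz product `ℜ_F(ix)` is essentially bounded by `exp(‖x‖² / 2)`. -/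
theorem ae_norm_rieszL2_le {A : Type*} (F : Set A) (x : lp (fun _ : F => ℝ) 2) :
    ∀ᵐ ω ∂cubeMeasure A, ‖rieszL2 F x ω‖ ≤ Real.exp (‖x‖ ^ 2 / 2) := by
  classical
  have hlim := (hasSum_rieszL2 F x).comp Filter.tendsto_finset_powerset_atTop_atTop
  have hmem : rieszL2 F x ∈ closure (Set.range fun E : Finset A => ∑ S ∈ E.powerset,
      rieszCoeff F (fun α => Complex.I * (x α : ℂ)) S • walshL2 S) :=
    mem_closure_of_tendsto hlim (Filter.Eventually.of_forall fun E => ⟨E, rfl⟩)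
  obtain ⟨u, hu, hlim'⟩ := mem_closure_iff_seq_limit.1 hmem
  obtain ⟨φ, -, hφ⟩ := (tendstoInMeasure_of_tendsto_Lp hlim').exists_seq_tendsto_ae
  have hb : ∀ n, ∀ᵐ ω ∂cubeMeasure A, ‖u n ω‖ ≤ Real.exp (‖x‖ ^ 2 / 2) := by
    intro n
    obtain ⟨E, hE⟩ := hu n
    rw [← hE]
    have h2 : ∀ᵐ ω ∂cubeMeasure A, ∀ S ∈ E.powerset,
        (rieszCoeff F (fun α => Complex.I * (x α : ℂ)) S • walshL2 S : Lp ℂ 2 (cubeMeasure A)) ω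
          = rieszCoeff F (fun α => Complex.I * (x α : ℂ)) S * walsh S ω := by
      rw [Filter.eventually_all_finset]
      intro S _
      filter_upwards [(memLp_walsh S 2).coeFn_toLp, Lp.coeFn_smul
        (rieszCoeff F (fun α => Complex.I * (x α : ℂ)) S) (walshL2 S)] with ω h3 h4
      rw [h4, Pi.smul_apply, walshL2, h3, smul_eq_mul]
    filter_upwards [Lp.coeFn_finsetSum E.powerset (fun S => (rieszCoeff F (fun α => Complex.I * (x α : ℂ)) S •
      walshL2 S : Lp ℂ 2 (cubeMeasure A))), h2] with ω h5 h6
    rw [h5, Finset.sum_apply, Finset.sum_congr rfl h6]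
    exact norm_riesz_partial_le F x E ω
  filter_upwards [hφ, ae_all_iff.2 hb] with ω h7 h8
  exact le_of_tendsto h7.norm (Filter.Eventually.of_forall fun n => h8 _)

theorem memLp_rieszL2 {A : Type*} (F : Set A) (x : lp (fun _ : F => ℝ) 2) :
    MemLp (rieszL2 F x) ∞ (cubeMeasure A) :=
  MemLp.of_bound (Lp.aestronglyMeasurable _) _ (ae_norm_rieszL2_le F x)

/-- `ℜ_F(ix)` as an element of `L^∞(Ω_A, ℙ_A)`. -/
noncomputable def riesz {A : Type*} (F : Set A) (x : lp (fun _ : F => ℝ) 2) :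
    Lp ℂ ∞ (cubeMeasure A) :=
  (memLp_rieszL2 F x).toLp

/-- `Q_F(x) = Im ℜ_F(ix)`, a real-valued element of the complex space `L^∞(Ω_A, ℙ_A)`. -/
noncomputable def Q {A : Type*} (F : Set A) (x : lp (fun _ : F => ℝ) 2) :
    Lp ℂ ∞ (cubeMeasure A) :=
  (Complex.ofRealCLM.comp Complex.imCLM).compLp (riesz F x)

/-- Bessel's inequality: Walsh transforms of elements of `L^∞` are square summable. -/
theorem summable_walshCoeff_sq {A : Type*} (f : Lp ℂ ∞ (cubeMeasure A)) :
    Summable fun S : Finset A => ‖walshCoeff f S‖ ^ 2 := by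
  have hm : MemLp f 2 (cubeMeasure A) := (Lp.memLp f).mono_exponent le_top
  have h := (orthonormal_walshL2 A).inner_products_summable (x := hm.toLp)
  refine h.congr fun S => ?_
  rw [inner_walshL2, walshCoeff, walshCoeff]
  congr 2
  refine integral_congr_ae ?_
  filter_upwards [hm.coeFn_toLp] with ω hω
  rw [hω]

/-! ### The map `Φ₂` -/

/-- `C = ⋃_{k ≥ 1} W_{F,2k+1}`: the Walsh characters on `F` of odd order at least three. -/
def oddWalsh {A : Type*} (F : Set A) : Set (Finset A) :=
  {S | (S : Set A) ⊆ F ∧ ∃ k : ℕ, 1 ≤ k ∧ S.card = 2 * k + 1}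

/-- The data from which `Φ₂` is built: a partition of `A` into sequentially many sets `A_j` of the
same cardinality as `A`, a bijection from `A` to the first of them, and bijections `C_j → A_{j+1}`.
The sets are numbered from `0` here. -/
structure Scheme (A : Type*) where
  part : ℕ → Set A
  disjoint : Pairwise fun i j => Disjoint (part i) (part j)
  iUnion_part : ⋃ j, part j = Set.univ
  mk_part : ∀ j, Cardinal.mk (part j) = Cardinal.mk A
  tau0 : A ≃ part 0
  tau : ∀ j, oddWalsh (part j) ≃ part (j + 1)

/-- The normalization `σ_t x = x / (t ‖x‖₂)`, `σ_t 0 = 0`. -/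
noncomputable def sigma {F : Type*} (t : ℝ) (x : lp (fun _ : F => ℝ) 2) : lp (fun _ : F => ℝ) 2 :=
  open Classical in if x = 0 then 0 else (t * ‖x‖)⁻¹ • x

theorem memlp_two_of_sq {F : Type*} {f : F → ℝ} (h : Summable fun α => ‖f α‖ ^ 2) : Memℓp f 2 := by
  refine memℓp_gen ?_
  simpa using h

theorem memlp_comp_equiv {F G : Type*} (e : G ≃ F) (x : lp (fun _ : F => ℝ) 2) :
    Memℓp (fun β => x (e β)) 2 := by
  have h := (lp.memℓp x).summable (by norm_num)
  refine memlp_two_of_sq ?_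
  have h2 : Summable fun α => ‖x α‖ ^ 2 := by simpa using h
  exact (e.summable_iff (f := fun α => ‖x α‖ ^ 2)).2 h2

theorem memlp_next {A : Type*} (s : Scheme A) (j : ℕ) (r : ℝ) (f : Lp ℂ ∞ (cubeMeasure A)) :
    Memℓp (fun β : s.part (j + 1) => r * (walshCoeff f ((s.tau j).symm β).1).re) 2 := by
  refine memlp_two_of_sq ?_
  have h1 : Summable fun β : s.part (j + 1) => ‖walshCoeff f ((s.tau j).symm β).1‖ ^ 2 :=
    (summable_walshCoeff_sq f).comp_injective
      (Subtype.val_injective.comp (s.tau j).symm.injective)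
  refine Summable.of_nonneg_of_le (fun _ => by positivity) (fun β => ?_) (h1.mul_left (r ^ 2))
  rw [norm_mul, mul_pow, Real.norm_eq_abs, sq_abs]
  gcongr
  exact Complex.abs_re_le_norm _

/-- The sequence `x^{(j)} ∈ l²_ℝ(A_j)` attached to `x ∈ l²_ℝ(A)`. (The Walsh transform of the
real-valued function `Q` is real, so that taking the real part only changes its type.) -/
noncomputable def iter {A : Type*} (s : Scheme A) (t : ℝ) (x : lp (fun _ : A => ℝ) 2) :
    (j : ℕ) → lp (fun _ : s.part j => ℝ) 2
  | 0 => ⟨fun β => x (s.tau0.symm β), memlp_comp_equiv s.tau0.symm x⟩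
  | j + 1 => ⟨fun β => t * ‖iter s t x j‖ *
      (walshCoeff (Q (s.part j) (sigma t (iter s t x j))) ((s.tau j).symm β).1).re,
      memlp_next s j _ _⟩

/-- `t ‖x^{(j)}‖₂ Q_{A_j}(σ_t x^{(j)})` for `x ∈ l²_ℝ(A)`. -/
noncomputable def block {A : Type*} (s : Scheme A) (t : ℝ) (x : lp (fun _ : A => ℝ) 2) (j : ℕ) :
    Lp ℂ ∞ (cubeMeasure A) :=
  ((t * ‖iter s t x j‖ : ℝ) : ℂ) • Q (s.part j) (sigma t (iter s t x j))

/-- `Φ₂(x;t)` for `x ∈ l²_ℝ(A)`: the sum of the series in `L^∞(Ω_A, ℙ_A)`. -/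
noncomputable def PhiReal {A : Type*} (s : Scheme A) (t : ℝ) (x : lp (fun _ : A => ℝ) 2) :
    Lp ℂ ∞ (cubeMeasure A) :=
  ∑' j : ℕ, Complex.I ^ j • block s t x j

theorem memlp_of_le {A : Type*} (x : lp (fun _ : A => ℂ) 2) (f : A → ℝ)
    (hf : ∀ α, ‖f α‖ ≤ ‖x α‖) : Memℓp f 2 := by
  have h := (lp.memℓp x).summable (by norm_num)
  have h2 : Summable fun α => ‖x α‖ ^ 2 := by simpa using h
  exact memlp_two_of_sq (Summable.of_nonneg_of_le (fun _ => by positivity)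
    (fun α => pow_le_pow_left₀ (norm_nonneg _) (hf α) 2) h2)

/-- The real part of `x ∈ l²(A)`. -/
noncomputable def rePart {A : Type*} (x : lp (fun _ : A => ℂ) 2) : lp (fun _ : A => ℝ) 2 :=
  ⟨fun α => (x α).re, memlp_of_le x _ fun _ => Complex.abs_re_le_norm _⟩

/-- The imaginary part of `x ∈ l²(A)`. -/
noncomputable def imPart {A : Type*} (x : lp (fun _ : A => ℂ) 2) : lp (fun _ : A => ℝ) 2 :=
  ⟨fun α => (x α).im, memlp_of_le x _ fun _ => Complex.abs_im_le_norm _⟩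

/-- `Φ₂(x;t) = Φ₂(u;t) + i Φ₂(v;t)` for `x = u + i v ∈ l²(A)`. -/
noncomputable def Phi {A : Type*} (s : Scheme A) (t : ℝ) (x : lp (fun _ : A => ℂ) 2) :
    Lp ℂ ∞ (cubeMeasure A) :=
  PhiReal s t (rePart x) + Complex.I • PhiReal s t (imPart x)

/-- `t ‖x^{(j)}‖₂ (Q_{A_j}(σ_t x^{(j)}))^(w_S)` for `x ∈ l²_ℝ(A)`. -/
noncomputable def blockCoeffReal {A : Type*} (s : Scheme A) (t : ℝ) (x : lp (fun _ : A => ℝ) 2)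
    (j : ℕ) (S : Finset A) : ℂ :=
  ((t * ‖iter s t x j‖ : ℝ) : ℂ) * walshCoeff (Q (s.part j) (sigma t (iter s t x j))) S

/-- The extension of `blockCoeffReal` to `x = u + i v ∈ l²(A)`, in the same way as for `Φ₂`. -/
noncomputable def blockCoeff {A : Type*} (s : Scheme A) (t : ℝ) (x : lp (fun _ : A => ℂ) 2)
    (j : ℕ) (S : Finset A) : ℂ :=
  blockCoeffReal s t (rePart x) j S + Complex.I * blockCoeffReal s t (imPart x) j S

/-- `K(t) = t e^{1/(2t²)} / (1 - t √(sinh(1/t²) - 1/t²))`. -/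
noncomputable def K (t : ℝ) : ℝ :=
  t * Real.exp (1 / (2 * t ^ 2)) / (1 - t * √(Real.sinh (1 / t ^ 2) - 1 / t ^ 2))

end WalshParseval

namespace WalshParseval

/-! ### The inclusion of `L^∞` into `L²` -/

/-! Everything is read off Walsh coefficients. Those of `Q F z` vanish on sets of even order or not
contained in `F`, and equal `±∏ z α` on the odd sets `S ⊆ F`, with value `z α` on singletons
(`hasSum_Q`). Since the factor `t‖x^{(j)}‖` undoes `sigma`, the order-one part of the block `Θ_j(x)`
is `x^{(j)}` itself, and its part of odd order at least three, relabelled by `tau j`, is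
`x^{(j+1)}`. Writing `D j` for the bilinear form `∑ x^{(j)} y^{(j)}`, this gives `∫ Θ_j(x) Θ_j(y) =
D j + D (j + 1)` (`pairing_complexBlock_self`).

Blocks living on different `A_j` are orthogonal, because these sets are disjoint and no block has a
constant term. Counting `j` from `0`, the two factors `I ^ j` produce the sign `(-1)^j`, so `∫ Φ₂(x)
Φ₂(y)` telescopes to `D 0 = ∑ x y`, provided `D n → 0` (`integral_Phi_mul_Phi`).

The remainder decays geometrically. The products `∏ z(α)²` over odd sets of order at least three sum
to at most `sinh ‖z‖² - ‖z‖²` (`sum_prod_odd_le`), and `‖z‖ ≤ 1/t` after normalization. Hence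
`‖x^{(j+1)}‖ ≤ ratio t * ‖x^{(j)}‖`, with `ratio t ^ 2 = t² sinh(1/t²) - 1`, which is below `1` when
`t > c` (`norm_iter_succ_le`, `thresholdFun_lt`, `ratio_lt_one`). Together with `‖Q F z‖ ≤
exp(‖z‖²/2)` this gives absolute convergence in `L^∞` and the constant `K t`.

Continuity into `L²` holds blockwise because the Riesz product is continuous into `L²`
(`continuous_rieszL2`), and passes to the series by dominated convergence. Homogeneity holds because
positive scaling does not affect `sigma` and `Q` is odd. -/

theorem memLp_two {A : Type*} (f : Lp ℂ ∞ (cubeMeasure A)) : MemLp f 2 (cubeMeasure A) :=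
  (Lp.memLp f).mono_exponent le_top

/-- The inclusion of `L^∞(Ω_A, ℙ_A)` into `L²(Ω_A, ℙ_A)`. -/
noncomputable def toL2 {A : Type*} : Lp ℂ ∞ (cubeMeasure A) →L[ℂ] Lp ℂ 2 (cubeMeasure A) :=
  LinearMap.mkContinuous
    { toFun := fun f => (memLp_two f).toLp
      map_add' := fun f g => by
        rw [← MemLp.toLp_add]
        exact MemLp.toLp_congr _ _ (Lp.coeFn_add f g)
      map_smul' := fun c f => by
        rw [RingHom.id_apply, ← MemLp.toLp_const_smul]
        exact MemLp.toLp_congr _ _ (Lp.coeFn_smul c f) } 1 fun f => by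
    change ‖(memLp_two f).toLp‖ ≤ _
    rw [one_mul, Lp.norm_toLp, Lp.norm_def]
    exact ENNReal.toReal_mono (Lp.eLpNorm_ne_top f)
      (eLpNorm_le_eLpNorm_of_exponent_le le_top (Lp.aestronglyMeasurable f))

theorem coeFn_toL2 {A : Type*} (f : Lp ℂ ∞ (cubeMeasure A)) : toL2 f =ᵐ[cubeMeasure A] f :=
  (memLp_two f).coeFn_toLp

theorem norm_toL2_le {A : Type*} (f : Lp ℂ ∞ (cubeMeasure A)) : ‖toL2 f‖ ≤ ‖f‖ :=
  ((LinearMap.mkContinuous_norm_le _ zero_le_one _ : ‖toL2 (A := A)‖ ≤ 1)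
    |> ContinuousLinearMap.le_of_opNorm_le _) f |>.trans_eq (one_mul _)

/-- Lets identities in `L^∞` be checked on Walsh series, which are summed in `L²`. -/
theorem toL2_injective {A : Type*} : Function.Injective (toL2 (A := A)) := fun f g h => by
  refine Lp.ext ((coeFn_toL2 f).symm.trans ?_)
  rw [h]
  exact coeFn_toL2 g

theorem walshCoeff_eq_inner {A : Type*} (f : Lp ℂ ∞ (cubeMeasure A)) (S : Finset A) :
    walshCoeff f S = inner ℂ (walshL2 S) (toL2 f) := by
  rw [inner_walshL2, walshCoeff, walshCoeff]
  refine integral_congr_ae ?_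
  filter_upwards [coeFn_toL2 f] with ω hω
  rw [hω]

theorem hasSum_inner_walshL2 {A : Type*} {a : Finset A → ℂ} {f : Lp ℂ 2 (cubeMeasure A)}
    (h : HasSum (fun S => a S • walshL2 S) f) (S : Finset A) : inner ℂ (walshL2 S) f = a S := by
  classical
  have h1 := (innerSL ℂ (walshL2 S)).hasSum h
  have h2 : HasSum (fun T => innerSL ℂ (walshL2 S) (a T • walshL2 T)) (a S) := by
    convert hasSum_ite_eq S (a S) using 2 with T
    rw [innerSL_apply_apply, inner_smul_right, orthonormal_iff_ite.1 (orthonormal_walshL2 A)]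
    by_cases hT : T = S
    · simp [hT]
    · simp [hT, Ne.symm hT]
  exact h1.unique h2

/-- Pairing `f` with its own series gives Parseval's identity without completeness of the Walsh
system. -/
theorem hasSum_norm_sq_of_hasSum {A : Type*} {a : Finset A → ℂ} {f : Lp ℂ 2 (cubeMeasure A)}
    (h : HasSum (fun S => a S • walshL2 S) f) : HasSum (fun S => ‖a S‖ ^ 2) (‖f‖ ^ 2) := by
  have h1 := (innerSL ℂ f).hasSum h
  have h2 := Complex.reCLM.hasSum h1
  convert h2 using 1
  · funext S
    simp only [innerSL_apply_apply, inner_smul_right, Complex.reCLM_apply]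
    rw [← inner_conj_symm, hasSum_inner_walshL2 h, Complex.mul_conj, Complex.ofReal_re,
      Complex.sq_norm]
  · simp only [innerSL_apply_apply, Complex.reCLM_apply]
    exact (inner_self_eq_norm_sq (𝕜 := ℂ) f).symm

/-! ### Walsh coefficients of `Q` -/

open Classical in
/-- Extension by zero. -/
noncomputable def ext {A : Type*} (F : Set A) (x : F → ℝ) (α : A) : ℝ :=
  if h : α ∈ F then x ⟨α, h⟩ else 0

theorem ext_sq {A : Type*} (F : Set A) (x : lp (fun _ : F => ℝ) 2) :
    HasSum (fun α => ext F x α ^ 2) (‖x‖ ^ 2) := by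
  convert summable_sq_extend F x using 2 with α
  rw [ext]
  split_ifs <;> simp

/-- Once `I ^ S.card` is split off the product is real, so taking imaginary parts kills the even
orders and keeps the odd ones up to sign. -/
theorem rieszCoeff_eq {A : Type*} (F : Set A) (x : F → ℝ) (S : Finset A) :
    rieszCoeff F (fun α => Complex.I * (x α : ℂ)) S
      = Complex.I ^ S.card * ((∏ α ∈ S, ext F x α : ℝ) : ℂ) := by
  rw [rieszCoeff, ← Finset.prod_const, Complex.ofReal_prod, ← Finset.prod_mul_distrib]
  refine Finset.prod_congr rfl fun α _ => ?_
  rw [ext]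
  split_ifs <;> simp

/-- The Walsh coefficients of `Q_F(x)`. -/
noncomputable def qCoeff {A : Type*} (F : Set A) (x : F → ℝ) (S : Finset A) : ℝ :=
  (Complex.I ^ S.card).im * ∏ α ∈ S, ext F x α

theorem im_rieszCoeff {A : Type*} (F : Set A) (x : F → ℝ) (S : Finset A) :
    (rieszCoeff F (fun α => Complex.I * (x α : ℂ)) S).im = qCoeff F x S := by
  rw [rieszCoeff_eq, qCoeff, Complex.im_mul_ofReal]

theorem I_pow_even_im {n : ℕ} (h : Even n) : (Complex.I ^ n).im = 0 := by
  obtain ⟨k, rfl⟩ := h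
  rw [← two_mul, pow_mul, Complex.I_sq]
  rcases neg_one_pow_eq_or ℂ k with h | h <;> simp [h]

theorem I_pow_odd_im_sq {n : ℕ} (h : Odd n) : (Complex.I ^ n).im ^ 2 = 1 := by
  obtain ⟨k, rfl⟩ := h
  rw [pow_succ Complex.I, pow_mul, Complex.I_sq]
  rcases neg_one_pow_eq_or ℂ k with h | h <;> simp [h]

theorem qCoeff_even {A : Type*} (F : Set A) (x : F → ℝ) {S : Finset A} (h : Even S.card) :
    qCoeff F x S = 0 := by
  rw [qCoeff, I_pow_even_im h, zero_mul]

theorem qCoeff_of_not_subset {A : Type*} (F : Set A) (x : F → ℝ) {S : Finset A}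
    (h : ¬ (S : Set A) ⊆ F) : qCoeff F x S = 0 := by
  obtain ⟨α, hα, hF⟩ := Set.not_subset.1 h
  rw [qCoeff, Finset.prod_eq_zero (Finset.mem_coe.1 hα) (by simp [ext, hF]), mul_zero]

theorem qCoeff_singleton {A : Type*} (F : Set A) (x : F → ℝ) (α : F) :
    qCoeff F x {α.1} = x α := by
  simp [qCoeff, ext]

theorem qCoeff_sq {A : Type*} (F : Set A) (x : F → ℝ) {S : Finset A} (h : Odd S.card) :
    qCoeff F x S ^ 2 = ∏ α ∈ S, ext F x α ^ 2 := by
  rw [qCoeff, mul_pow, I_pow_odd_im_sq h, one_mul, Finset.prod_pow]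

theorem qCoeff_neg {A : Type*} (F : Set A) (x : F → ℝ) (S : Finset A) :
    qCoeff F (-x) S = -qCoeff F x S := by
  rcases Nat.even_or_odd S.card with h | h
  · rw [qCoeff_even F _ h, qCoeff_even F _ h, neg_zero]
  · have h1 : ∀ α, ext F (-x) α = -1 * ext F x α := fun α => by
      rw [ext, ext]; split_ifs <;> simp
    simp only [qCoeff, h1, Finset.prod_mul_distrib, Finset.prod_const, h.neg_one_pow]
    ring

/-- The map `f ↦ Im f` on `L²(Ω_A, ℙ_A)`. -/
noncomputable def imL2 (A : Type*) : Lp ℂ 2 (cubeMeasure A) →L[ℝ] Lp ℂ 2 (cubeMeasure A) :=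
  (Complex.ofRealCLM.comp Complex.imCLM).compLpL 2 (cubeMeasure A)

theorem coeFn_imL2 {A : Type*} (f : Lp ℂ 2 (cubeMeasure A)) :
    imL2 A f =ᵐ[cubeMeasure A] fun ω => ((f ω).im : ℂ) :=
  (Complex.ofRealCLM.comp Complex.imCLM).coeFn_compLpL f

theorem coeFn_walshL2 {A : Type*} (S : Finset A) : walshL2 S =ᵐ[cubeMeasure A] walsh S :=
  (memLp_walsh S 2).coeFn_toLp

/-- Walsh characters are real, so `Im` acts on a Walsh series coefficient by coefficient. It is only
real-linear, hence the scalar field of `imL2`. -/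
theorem imL2_smul_walshL2 {A : Type*} (c : ℂ) (S : Finset A) :
    imL2 A (c • walshL2 S) = (c.im : ℂ) • walshL2 S := by
  refine Lp.ext ?_
  filter_upwards [coeFn_imL2 (c • walshL2 S), Lp.coeFn_smul c (walshL2 S),
    Lp.coeFn_smul (c.im : ℂ) (walshL2 S), coeFn_walshL2 S] with ω h1 h2 h3 h4
  have h5 : (walsh S ω).im = 0 := Complex.conj_eq_iff_im.1 (conj_walsh S ω)
  have h6 : ((walsh S ω).re : ℂ) = walsh S ω := Complex.conj_eq_iff_re.1 (conj_walsh S ω)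
  rw [h1, h2, h3, Pi.smul_apply, Pi.smul_apply, h4, smul_eq_mul, smul_eq_mul, Complex.mul_im, h5,
    mul_zero, zero_add, Complex.ofReal_mul, h6]

theorem coeFn_Q {A : Type*} (F : Set A) (x : lp (fun _ : F => ℝ) 2) :
    Q F x =ᵐ[cubeMeasure A] fun ω => ((rieszL2 F x ω).im : ℂ) := by
  filter_upwards [(Complex.ofRealCLM.comp Complex.imCLM).coeFn_compLp (riesz F x),
    (memLp_rieszL2 F x).coeFn_toLp] with ω h1 h2
  rw [Q, h1, riesz, h2]
  rfl

theorem toL2_Q {A : Type*} (F : Set A) (x : lp (fun _ : F => ℝ) 2) :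
    toL2 (Q F x) = imL2 A (rieszL2 F x) := by
  refine Lp.ext ?_
  filter_upwards [coeFn_toL2 (Q F x), coeFn_Q F x, coeFn_imL2 (rieszL2 F x)] with ω h1 h2 h3
  rw [h1, h2, h3]

theorem norm_Q_le {A : Type*} (F : Set A) (x : lp (fun _ : F => ℝ) 2) :
    ‖Q F x‖ ≤ Real.exp (‖x‖ ^ 2 / 2) := by
  have h := Lp.norm_le_of_ae_bound (f := Q F x) (Real.exp_pos (‖x‖ ^ 2 / 2)).le (by
    filter_upwards [coeFn_Q F x, ae_norm_rieszL2_le F x] with ω h1 h2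
    rw [h1, Complex.norm_real]
    exact (Complex.abs_im_le_norm _).trans h2)
  simpa using h

theorem hasSum_Q {A : Type*} (F : Set A) (x : lp (fun _ : F => ℝ) 2) :
    HasSum (fun S : Finset A => (qCoeff F x S : ℂ) • walshL2 S) (toL2 (Q F x)) := by
  rw [toL2_Q]
  convert (imL2 A).hasSum (hasSum_rieszL2 F x) using 2 with S
  rw [← im_rieszCoeff]
  exact (imL2_smul_walshL2 _ _).symm

theorem walshCoeff_Q {A : Type*} (F : Set A) (x : lp (fun _ : F => ℝ) 2) (S : Finset A) :
    walshCoeff (Q F x) S = qCoeff F x S := by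
  rw [walshCoeff_eq_inner, hasSum_inner_walshL2 (hasSum_Q F x)]

theorem Q_neg {A : Type*} (F : Set A) (x : lp (fun _ : F => ℝ) 2) : Q F (-x) = -Q F x := by
  refine toL2_injective ?_
  rw [map_neg]
  refine (hasSum_Q F (-x)).unique ?_
  convert (hasSum_Q F x).neg using 2 with S
  rw [← neg_smul, lp.coeFn_neg, qCoeff_neg, Complex.ofReal_neg]

/-! ### Hyperbolic bounds for sums over odd sets -/

/-- Adjoining `b` exchanges parities: the odd sum gains `a b` times the even sum, and conversely.
The addition formulas for `sinh` and `cosh` dominate this recursion because `a b ≤ sinh (a b)` and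
`1 ≤ cosh (a b)`, so both bounds are carried through one induction. -/
theorem sum_prod_parity_le {A : Type*} [DecidableEq A] (a : A → ℝ) (ha : ∀ α, 0 ≤ a α)
    (E : Finset A) :
    ∑ S ∈ E.powerset, (if Odd S.card then ∏ α ∈ S, a α else 0) ≤ Real.sinh (∑ α ∈ E, a α) ∧
      ∑ S ∈ E.powerset, (if Even S.card then ∏ α ∈ S, a α else 0)
        ≤ Real.cosh (∑ α ∈ E, a α) := by
  induction E using Finset.induction_on with
  | empty => simp
  | insert b E hb ih =>
    have h1 : ∀ S ∈ E.powerset, b ∉ S := fun S hS h => hb (Finset.mem_powerset.1 hS h)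
    have hodd : ∑ S ∈ E.powerset, (if Odd (insert b S).card then ∏ α ∈ insert b S, a α else 0)
        = a b * ∑ S ∈ E.powerset, (if Even S.card then ∏ α ∈ S, a α else 0) := by
      rw [Finset.mul_sum]
      refine Finset.sum_congr rfl fun S hS => ?_
      rw [Finset.card_insert_of_notMem (h1 S hS), Finset.prod_insert (h1 S hS), mul_ite, mul_zero]
      simp only [Nat.odd_add_one, Nat.not_odd_iff_even]
    have heven : ∑ S ∈ E.powerset, (if Even (insert b S).card then ∏ α ∈ insert b S, a α else 0)
        = a b * ∑ S ∈ E.powerset, (if Odd S.card then ∏ α ∈ S, a α else 0) := by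
      rw [Finset.mul_sum]
      refine Finset.sum_congr rfl fun S hS => ?_
      rw [Finset.card_insert_of_notMem (h1 S hS), Finset.prod_insert (h1 S hS), mul_ite, mul_zero]
      simp only [Nat.even_add_one, Nat.not_even_iff_odd]
    rw [Finset.sum_powerset_insert hb, Finset.sum_powerset_insert hb, hodd, heven,
      Finset.sum_insert hb, add_comm (a b), Real.sinh_add, Real.cosh_add]
    set p := ∑ α ∈ E, a α
    have hp : 0 ≤ p := Finset.sum_nonneg fun α _ => ha α
    have hs : 0 ≤ Real.sinh p := Real.sinh_nonneg_iff.2 hp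
    have hc : 0 ≤ Real.cosh p := (Real.cosh_pos p).le
    have hsb : a b ≤ Real.sinh (a b) := Real.self_le_sinh_iff.2 (ha b)
    have hcb : 1 ≤ Real.cosh (a b) := Real.one_le_cosh _
    constructor
    · have e1 := mul_le_mul_of_nonneg_left ih.2 (ha b)
      have e2 := mul_le_mul_of_nonneg_left hsb hc
      have e3 := mul_le_mul_of_nonneg_left hcb hs
      linarith [ih.1]
    · have e1 := mul_le_mul_of_nonneg_left ih.1 (ha b)
      have e2 := mul_le_mul_of_nonneg_left hsb hs
      have e3 := mul_le_mul_of_nonneg_left hcb hc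
      linarith [ih.2]

/-- Adjoining to `𝒮` all singletons of a finite set `E` that contains its members keeps the total at
most `sinh` of the sum over `E`; the singletons account for exactly that sum, which may be
subtracted. -/
theorem sum_prod_odd_le {A : Type*} (a : A → ℝ) (ha : ∀ α, 0 ≤ a α) {P : ℝ} (hP : HasSum a P)
    (𝒮 : Finset (Finset A)) (h𝒮 : ∀ S ∈ 𝒮, Odd S.card ∧ S.card ≠ 1) :
    ∑ S ∈ 𝒮, ∏ α ∈ S, a α ≤ Real.sinh P - P := by
  classical
  set E := 𝒮.sup id
  have hE : ∑ α ∈ E, a α ≤ P := sum_le_hasSum E (fun α _ => ha α) hP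
  -- The singletons of `E` yield only the partial sum, not `P`; monotonicity of `sinh - id` bridges
  -- the gap.
  refine le_trans ?_ (Real.sinh_sub_id_strictMono.monotone hE)
  have h1 := (sum_prod_parity_le a ha E).1
  rw [← Finset.sum_filter] at h1
  have h2 : ∑ S ∈ E.map ⟨fun α => {α}, Finset.singleton_injective⟩, ∏ α ∈ S, a α
      = ∑ α ∈ E, a α := by simp
  have hd : Disjoint 𝒮 (E.map ⟨fun α => {α}, Finset.singleton_injective⟩) := by
    rw [Finset.disjoint_left]
    intro S hS hS'
    obtain ⟨α, -, rfl⟩ := Finset.mem_map.1 hS'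
    exact (h𝒮 _ hS).2 (Finset.card_singleton α)
  have h3 : ∑ S ∈ 𝒮 ∪ E.map ⟨fun α => {α}, Finset.singleton_injective⟩, ∏ α ∈ S, a α
      ≤ ∑ S ∈ E.powerset with Odd S.card, ∏ α ∈ S, a α := by
    refine Finset.sum_le_sum_of_subset_of_nonneg ?_ fun S _ _ => Finset.prod_nonneg fun α _ => ha α
    intro S hS
    rw [Finset.mem_filter, Finset.mem_powerset]
    rcases Finset.mem_union.1 hS with hS | hS
    · exact ⟨Finset.le_sup (f := id) hS, (h𝒮 S hS).1⟩
    · obtain ⟨α, hα, rfl⟩ := Finset.mem_map.1 hS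
      simp [hα]
  rw [Finset.sum_union hd, h2] at h3
  linarith

/-! ### Continuity of the Riesz product -/

/-- Induction on `x X - y Y = x (X - Y) + (x - y) Y` with `(a + b)² ≤ 2a² + 2b²`. The bound is a
difference of products so that its sum over all `S ⊆ E` is again a difference of two products. -/
theorem prod_sub_prod_sq_le {A : Type*} (x y : A → ℝ) (S : Finset A) :
    (∏ α ∈ S, x α - ∏ α ∈ S, y α) ^ 2
      ≤ ∏ α ∈ S, (2 * x α ^ 2 + 2 * (x α - y α) ^ 2) - ∏ α ∈ S, 2 * x α ^ 2 := by
  classical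
  induction S using Finset.induction_on with
  | empty => simp
  | insert b S hb ih =>
    simp only [Finset.prod_insert hb]
    set X := ∏ α ∈ S, x α
    set Y := ∏ α ∈ S, y α
    have hY : Y ^ 2 ≤ ∏ α ∈ S, (2 * x α ^ 2 + 2 * (x α - y α) ^ 2) := by
      rw [← Finset.prod_pow]
      refine Finset.prod_le_prod (fun α _ => sq_nonneg _) fun α _ => ?_
      -- `2x² + 2(x - y)² - y² = (2x - y)²`.
      nlinarith [sq_nonneg (2 * x α - y α)]
    set U := ∏ α ∈ S, (2 * x α ^ 2 + 2 * (x α - y α) ^ 2)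
    set V := ∏ α ∈ S, 2 * x α ^ 2
    have e1 := mul_le_mul_of_nonneg_left ih (sq_nonneg (x b))
    have e2 := mul_le_mul_of_nonneg_left hY (sq_nonneg (x b - y b))
    have e3 : (x b * X - y b * Y) ^ 2
        ≤ 2 * (x b ^ 2 * (X - Y) ^ 2) + 2 * ((x b - y b) ^ 2 * Y ^ 2) := by
      nlinarith [sq_nonneg (x b * (X - Y) - (x b - y b) * Y)]
    linarith

/-- Summing over subsets gives products of `1 + 2x² + 2(x - y)² ≤ (1 + 2x²)(1 + 2(x - y)²)`, and `1
+ u ≤ exp u` finishes. For fixed `p` the bound tends to `0` with `r`, which is what continuity of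
the Riesz product requires. -/
theorem sum_prod_sub_prod_sq_le {A : Type*} (x y : A → ℝ) {p r : ℝ}
    (hp : HasSum (fun α => x α ^ 2) p) (hr : HasSum (fun α => (x α - y α) ^ 2) r)
    (𝒮 : Finset (Finset A)) :
    ∑ S ∈ 𝒮, (∏ α ∈ S, x α - ∏ α ∈ S, y α) ^ 2
      ≤ Real.exp (2 * p) * (Real.exp (2 * r) - 1) := by
  classical
  set E := 𝒮.sup id
  have hE : 𝒮 ⊆ E.powerset := fun S hS => Finset.mem_powerset.2 (Finset.le_sup (f := id) hS)
  have hexp : ∀ (f : A → ℝ) (P : ℝ), (∀ α, 0 ≤ f α) → HasSum f P →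
      ∏ α ∈ E, (1 + 2 * f α) ≤ Real.exp (2 * P) := fun f P hf hP => by
    calc ∏ α ∈ E, (1 + 2 * f α) ≤ ∏ α ∈ E, Real.exp (2 * f α) := by
          refine Finset.prod_le_prod (fun α _ => by linarith [hf α]) fun α _ => ?_
          linarith [Real.add_one_le_exp (2 * f α)]
      _ = Real.exp (2 * ∑ α ∈ E, f α) := by rw [← Real.exp_sum, Finset.mul_sum]
      _ ≤ _ := by
          rw [Real.exp_le_exp]
          linarith [sum_le_hasSum E (fun α _ => hf α) hP]
  have h1 := hexp _ _ (fun α => sq_nonneg (x α)) hp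
  have h2 := hexp _ _ (fun α => sq_nonneg (x α - y α)) hr
  have hpos : 1 ≤ ∏ α ∈ E, (1 + 2 * x α ^ 2) := by
    refine Finset.prod_induction _ (fun b => 1 ≤ b)
      (fun _ _ => one_le_mul_of_one_le_of_one_le) le_rfl fun α _ => ?_
    linarith [sq_nonneg (x α)]
  have hpos' : 1 ≤ ∏ α ∈ E, (1 + 2 * (x α - y α) ^ 2) := by
    refine Finset.prod_induction _ (fun b => 1 ≤ b)
      (fun _ _ => one_le_mul_of_one_le_of_one_le) le_rfl fun α _ => ?_
    linarith [sq_nonneg (x α - y α)]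
  calc ∑ S ∈ 𝒮, (∏ α ∈ S, x α - ∏ α ∈ S, y α) ^ 2
      ≤ ∑ S ∈ E.powerset, (∏ α ∈ S, x α - ∏ α ∈ S, y α) ^ 2 :=
        Finset.sum_le_sum_of_subset_of_nonneg hE fun _ _ _ => sq_nonneg _
    _ ≤ ∑ S ∈ E.powerset,
        (∏ α ∈ S, (2 * x α ^ 2 + 2 * (x α - y α) ^ 2) - ∏ α ∈ S, 2 * x α ^ 2) :=
        Finset.sum_le_sum fun S _ => prod_sub_prod_sq_le x y S
    _ = ∏ α ∈ E, (1 + (2 * x α ^ 2 + 2 * (x α - y α) ^ 2)) - ∏ α ∈ E, (1 + 2 * x α ^ 2) := by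
        rw [Finset.sum_sub_distrib, Finset.prod_one_add, Finset.prod_one_add]
    _ ≤ (∏ α ∈ E, (1 + 2 * x α ^ 2)) * (∏ α ∈ E, (1 + 2 * (x α - y α) ^ 2))
          - ∏ α ∈ E, (1 + 2 * x α ^ 2) := by
        rw [← Finset.prod_mul_distrib]
        refine sub_le_sub_right (Finset.prod_le_prod (fun α _ => by positivity) fun α _ => ?_) _
        nlinarith [mul_nonneg (sq_nonneg (x α)) (sq_nonneg (x α - y α))]
    _ = (∏ α ∈ E, (1 + 2 * x α ^ 2)) * (∏ α ∈ E, (1 + 2 * (x α - y α) ^ 2) - 1) := by ring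
    _ ≤ Real.exp (2 * p) * (Real.exp (2 * r) - 1) := by
        refine mul_le_mul h1 (by linarith) (by linarith) (Real.exp_pos _).le

theorem norm_rieszL2_sub_sq_le {A : Type*} (F : Set A) (x y : lp (fun _ : F => ℝ) 2) :
    ‖rieszL2 F x - rieszL2 F y‖ ^ 2
      ≤ Real.exp (2 * ‖x‖ ^ 2) * (Real.exp (2 * ‖x - y‖ ^ 2) - 1) := by
  have h := (hasSum_rieszL2 F x).sub (hasSum_rieszL2 F y)
  simp_rw [← sub_smul] at h
  have h2 := hasSum_norm_sq_of_hasSum h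
  have hr : HasSum (fun α => (ext F x α - ext F y α) ^ 2) (‖x - y‖ ^ 2) := by
    convert ext_sq F (x - y) using 3 with α
    rw [ext, ext, ext]
    split_ifs <;> simp
  refine hasSum_le_of_sum_le h2 fun 𝒮 => ?_
  refine le_trans (le_of_eq ?_) (sum_prod_sub_prod_sq_le _ _ (ext_sq F x) hr 𝒮)
  refine Finset.sum_congr rfl fun S _ => ?_
  rw [rieszCoeff_eq, rieszCoeff_eq, ← mul_sub, norm_mul, norm_pow, Complex.norm_I, one_pow, one_mul,
    ← Complex.ofReal_sub, Complex.norm_real, Real.norm_eq_abs, sq_abs]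

theorem continuous_rieszL2 {A : Type*} (F : Set A) : Continuous (rieszL2 F) := by
  rw [continuous_iff_continuousAt]
  intro x
  rw [ContinuousAt, tendsto_iff_norm_sub_tendsto_zero]
  have h1 : Filter.Tendsto (fun y : lp (fun _ : F => ℝ) 2 =>
      √(Real.exp (2 * ‖x‖ ^ 2) * (Real.exp (2 * ‖x - y‖ ^ 2) - 1))) (nhds x) (nhds 0) := by
    have : Continuous (fun y : lp (fun _ : F => ℝ) 2 =>
      √(Real.exp (2 * ‖x‖ ^ 2) * (Real.exp (2 * ‖x - y‖ ^ 2) - 1))) := by fun_prop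
    simpa using this.tendsto x
  refine squeeze_zero (fun _ => norm_nonneg _) (fun y => ?_) h1
  rw [norm_sub_rev]
  exact Real.le_sqrt_of_sq_le (norm_rieszL2_sub_sq_le F x y)

theorem continuous_toL2_Q {A : Type*} (F : Set A) : Continuous fun x => toL2 (Q F x) := by
  simp_rw [toL2_Q]
  exact (imL2 A).continuous.comp (continuous_rieszL2 F)

/-! ### Estimates for the blocks -/

theorem sigma_of_ne {F : Type*} (t : ℝ) {x : lp (fun _ : F => ℝ) 2} (hx : x ≠ 0) :
    sigma t x = (t * ‖x‖)⁻¹ • x := by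
  rw [sigma, if_neg hx]

theorem norm_sigma_le {F : Type*} {t : ℝ} (ht : 0 < t) (x : lp (fun _ : F => ℝ) 2) :
    ‖sigma t x‖ ≤ 1 / t := by
  by_cases hx : x = 0
  · rw [sigma, if_pos hx, norm_zero]
    positivity
  · have hx' : 0 < ‖x‖ := norm_pos_iff.2 hx
    rw [sigma_of_ne t hx, norm_smul, Real.norm_eq_abs, abs_of_pos (by positivity)]
    apply le_of_eq
    field_simp

/-- `t ‖x‖₂ Q_F(σ_t x)`. -/
noncomputable def scaledQ {A : Type*} (F : Set A) (t : ℝ) (x : lp (fun _ : F => ℝ) 2) :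
    Lp ℂ ∞ (cubeMeasure A) :=
  ((t * ‖x‖ : ℝ) : ℂ) • Q F (sigma t x)

theorem block_eq {A : Type*} (s : Scheme A) (t : ℝ) (x : lp (fun _ : A => ℝ) 2) (j : ℕ) :
    block s t x j = scaledQ (s.part j) t (iter s t x j) := rfl

theorem norm_scaledQ_le {A : Type*} (F : Set A) {t : ℝ} (ht : 0 < t)
    (x : lp (fun _ : F => ℝ) 2) :
    ‖scaledQ F t x‖ ≤ t * Real.exp (1 / (2 * t ^ 2)) * ‖x‖ := by
  rw [scaledQ, norm_smul, Complex.norm_real, Real.norm_eq_abs, abs_of_nonneg (by positivity)]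
  have h : ‖Q F (sigma t x)‖ ≤ Real.exp (1 / (2 * t ^ 2)) := by
    refine (norm_Q_le F _).trans (Real.exp_le_exp.2 ?_)
    have h1 := pow_le_pow_left₀ (norm_nonneg _) (norm_sigma_le ht x) 2
    calc ‖sigma t x‖ ^ 2 / 2 ≤ (1 / t) ^ 2 / 2 := by linarith
      _ = 1 / (2 * t ^ 2) := by field_simp
  calc t * ‖x‖ * ‖Q F (sigma t x)‖ ≤ t * ‖x‖ * Real.exp (1 / (2 * t ^ 2)) := by gcongr
    _ = _ := by ring

theorem hasSum_scaledQ {A : Type*} (F : Set A) (t : ℝ) (x : lp (fun _ : F => ℝ) 2) :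
    HasSum (fun S => ((t * ‖x‖ * qCoeff F (sigma t x) S : ℝ) : ℂ) • walshL2 S)
      (toL2 (scaledQ F t x)) := by
  rw [scaledQ, map_smul]
  convert (hasSum_Q F (sigma t x)).const_smul ((t * ‖x‖ : ℝ) : ℂ) using 2 with S
  rw [smul_smul, ← Complex.ofReal_mul]

/-- Away from `0` this is a composition of continuous maps. At `0` the normalization cannot be used
for continuity, and the bound linear in `‖y‖` takes over. -/
theorem continuous_toL2_scaledQ {A : Type*} (F : Set A) {t : ℝ} (ht : 0 < t) :
    Continuous fun x => toL2 (scaledQ F t x) := by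
  rw [continuous_iff_continuousAt]
  intro x
  by_cases hx : x = 0
  · subst hx
    have h0 : toL2 (scaledQ F t 0) = 0 := by
      rw [scaledQ, norm_zero, mul_zero, Complex.ofReal_zero, zero_smul, map_zero]
    rw [ContinuousAt, h0]
    refine squeeze_zero_norm
      (fun y => (norm_toL2_le _).trans (norm_scaledQ_le F ht y)) ?_
    have : Continuous fun y : lp (fun _ : F => ℝ) 2 =>
      t * Real.exp (1 / (2 * t ^ 2)) * ‖y‖ := by fun_prop
    simpa using this.tendsto 0
  · have hx' : t * ‖x‖ ≠ 0 := mul_ne_zero ht.ne' (norm_ne_zero_iff.2 hx)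
    have h1 : ContinuousAt (fun y : lp (fun _ : F => ℝ) 2 => (t * ‖y‖)⁻¹ • y) x := by
      have h0 : ContinuousAt (fun y : lp (fun _ : F => ℝ) 2 => (t * ‖y‖)⁻¹) x :=
        ContinuousAt.inv₀ (f := fun y : lp (fun _ : F => ℝ) 2 => t * ‖y‖) (by fun_prop) hx'
      exact h0.smul continuousAt_id
    have h2 : ContinuousAt (sigma (F := F) t) x := by
      refine h1.congr ?_
      filter_upwards [isOpen_ne.mem_nhds hx] with y hy
      exact (sigma_of_ne t hy).symm
    have h3 : ContinuousAt (fun y => toL2 (Q F (sigma t y))) x :=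
      ContinuousAt.comp (f := sigma t) (g := fun y => toL2 (Q F y))
        (continuous_toL2_Q F).continuousAt h2
    simp only [scaledQ, map_smul]
    have h4 : Continuous fun y : lp (fun _ : F => ℝ) 2 => ((t * ‖y‖ : ℝ) : ℂ) :=
      Complex.continuous_ofReal.comp (continuous_const.mul continuous_norm)
    exact h4.continuousAt.smul h3

theorem iter_succ_apply {A : Type*} (s : Scheme A) (t : ℝ) (x : lp (fun _ : A => ℝ) 2) (j : ℕ)
    (β : s.part (j + 1)) :
    iter s t x (j + 1) β = t * ‖iter s t x j‖ *
      qCoeff (s.part j) (sigma t (iter s t x j)) ((s.tau j).symm β).1 := by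
  have : iter s t x (j + 1) β = t * ‖iter s t x j‖ *
      (walshCoeff (Q (s.part j) (sigma t (iter s t x j))) ((s.tau j).symm β).1).re := rfl
  rw [this, walshCoeff_Q, Complex.ofReal_re]

theorem iter_zero_apply {A : Type*} (s : Scheme A) (t : ℝ) (x : lp (fun _ : A => ℝ) 2)
    (β : s.part 0) : iter s t x 0 β = x (s.tau0.symm β) := rfl

theorem hasSum_sq_lp {F : Type*} (x : lp (fun _ : F => ℝ) 2) :
    HasSum (fun α => x α ^ 2) (‖x‖ ^ 2) := by
  simpa using lp.hasSum_norm (p := 2) (by norm_num) x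

theorem odd_card_of_mem_oddWalsh {A : Type*} {F : Set A} {S : Finset A} (h : S ∈ oddWalsh F) :
    Odd S.card ∧ S.card ≠ 1 := by
  obtain ⟨-, k, hk, hc⟩ := h
  exact ⟨⟨k, hc⟩, by omega⟩

/-- The ratio of the geometric series that dominates the series of `Φ₂`. -/
noncomputable def ratio (t : ℝ) : ℝ := t * √(Real.sinh (1 / t ^ 2) - 1 / t ^ 2)

theorem ratio_nonneg {t : ℝ} (ht : 0 < t) : 0 ≤ ratio t := by
  unfold ratio
  positivity

theorem norm_iter_zero {A : Type*} (s : Scheme A) (t : ℝ) (x : lp (fun _ : A => ℝ) 2) :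
    ‖iter s t x 0‖ = ‖x‖ := by
  have h1 := hasSum_sq_lp (iter s t x 0)
  have h2 := (s.tau0.symm.hasSum_iff (f := fun α => x α ^ 2)).2 (hasSum_sq_lp x)
  have h3 : ‖iter s t x 0‖ ^ 2 = ‖x‖ ^ 2 := h1.unique h2
  exact (pow_left_inj₀ (norm_nonneg _) (norm_nonneg _) two_ne_zero).1 h3

/-- The squared entries of the next iterate are, up to the factor `(t‖x^{(j)}‖)²`, products of
`z(α)²` over distinct odd sets of order at least three, where `‖z‖² ≤ 1/t²`. -/
theorem norm_iter_succ_le {A : Type*} (s : Scheme A) {t : ℝ} (ht : 0 < t)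
    (x : lp (fun _ : A => ℝ) 2) (j : ℕ) : ‖iter s t x (j + 1)‖ ≤ ratio t * ‖iter s t x j‖ := by
  classical
  have hn : 0 ≤ t * ‖iter s t x j‖ := by positivity
  refine (sq_le_sq₀ (norm_nonneg _) (mul_nonneg (ratio_nonneg ht) (norm_nonneg _))).1 ?_
  have hφ : 0 ≤ Real.sinh (1 / t ^ 2) - 1 / t ^ 2 :=
    sub_nonneg.2 (Real.self_le_sinh_iff.2 (by positivity))
  have h0 : (ratio t * ‖iter s t x j‖) ^ 2
      = (t * ‖iter s t x j‖) ^ 2 * (Real.sinh (1 / t ^ 2) - 1 / t ^ 2) := by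
    rw [ratio, mul_pow, mul_pow, Real.sq_sqrt hφ]
    ring
  rw [h0]
  refine hasSum_le_of_sum_le (hasSum_sq_lp _) fun 𝒯 => ?_
  set z := sigma t (iter s t x j)
  have hz : ‖z‖ ^ 2 ≤ 1 / t ^ 2 := by
    rw [← one_div_pow]
    exact pow_le_pow_left₀ (norm_nonneg _) (norm_sigma_le ht _) 2
  let e : s.part (j + 1) ↪ Finset A :=
    ⟨fun β => ((s.tau j).symm β).1, Subtype.val_injective.comp (s.tau j).symm.injective⟩
  have he : ∀ S ∈ 𝒯.map e, Odd S.card ∧ S.card ≠ 1 := fun S hS => by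
    obtain ⟨β, -, rfl⟩ := Finset.mem_map.1 hS
    exact odd_card_of_mem_oddWalsh ((s.tau j).symm β).2
  have h1 := sum_prod_odd_le _ (fun α => sq_nonneg (ext (s.part j) z α)) (ext_sq _ z) (𝒯.map e) he
  rw [Finset.sum_map] at h1
  calc ∑ β ∈ 𝒯, iter s t x (j + 1) β ^ 2
      = (t * ‖iter s t x j‖) ^ 2 * ∑ β ∈ 𝒯, ∏ α ∈ e β, ext (s.part j) z α ^ 2 := by
        rw [Finset.mul_sum]
        refine Finset.sum_congr rfl fun β _ => ?_
        rw [iter_succ_apply, mul_pow, qCoeff_sq _ _ (odd_card_of_mem_oddWalsh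
          ((s.tau j).symm β).2).1]
        rfl
    _ ≤ _ := by
        refine mul_le_mul_of_nonneg_left (h1.trans ?_) (sq_nonneg _)
        exact Real.sinh_sub_id_strictMono.monotone hz

theorem norm_iter_le {A : Type*} (s : Scheme A) {t : ℝ} (ht : 0 < t)
    (x : lp (fun _ : A => ℝ) 2) (j : ℕ) : ‖iter s t x j‖ ≤ ratio t ^ j * ‖x‖ := by
  induction j with
  | zero => rw [norm_iter_zero, pow_zero, one_mul]
  | succ j ih =>
    calc ‖iter s t x (j + 1)‖ ≤ ratio t * ‖iter s t x j‖ := norm_iter_succ_le s ht x j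
      _ ≤ ratio t * (ratio t ^ j * ‖x‖) := mul_le_mul_of_nonneg_left ih (ratio_nonneg ht)
      _ = _ := by ring

theorem norm_I_pow_smul_block_le {A : Type*} (s : Scheme A) {t : ℝ} (ht : 0 < t)
    (x : lp (fun _ : A => ℝ) 2) (j : ℕ) :
    ‖Complex.I ^ j • block s t x j‖
      ≤ t * Real.exp (1 / (2 * t ^ 2)) * ‖x‖ * ratio t ^ j := by
  rw [norm_smul, norm_pow, Complex.norm_I, one_pow, one_mul, block_eq]
  calc ‖scaledQ (s.part j) t (iter s t x j)‖
      ≤ t * Real.exp (1 / (2 * t ^ 2)) * ‖iter s t x j‖ := norm_scaledQ_le _ ht _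
    _ ≤ t * Real.exp (1 / (2 * t ^ 2)) * (ratio t ^ j * ‖x‖) := by
        gcongr
        exact norm_iter_le s ht x j
    _ = _ := by ring

theorem summable_norm_block {A : Type*} (s : Scheme A) {t : ℝ} (ht : 0 < t) (hr : ratio t < 1)
    (x : lp (fun _ : A => ℝ) 2) : Summable fun j => ‖Complex.I ^ j • block s t x j‖ :=
  Summable.of_nonneg_of_le (fun _ => norm_nonneg _) (norm_I_pow_smul_block_le s ht x)
    ((summable_geometric_of_lt_one (ratio_nonneg ht) hr).mul_left _)

theorem norm_PhiReal_le {A : Type*} (s : Scheme A) {t : ℝ} (ht : 0 < t) (hr : ratio t < 1)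
    (x : lp (fun _ : A => ℝ) 2) : ‖PhiReal s t x‖ ≤ K t * ‖x‖ := by
  refine (tsum_of_norm_bounded ((hasSum_geometric_of_lt_one (ratio_nonneg ht) hr).mul_left _)
    (norm_I_pow_smul_block_le s ht x)).trans_eq ?_
  rw [K, ratio]
  ring

theorem K_nonneg {t : ℝ} (ht : 0 < t) (hr : ratio t < 1) : 0 ≤ K t :=
  div_nonneg (by positivity) (sub_nonneg.2 hr.le)

theorem norm_lp_le_of_le {F : Type*} {f : lp (fun _ : F => ℝ) 2} {x : lp (fun _ : F => ℂ) 2}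
    (h : ∀ α, |f α| ≤ ‖x α‖) : ‖f‖ ≤ ‖x‖ := by
  refine (sq_le_sq₀ (norm_nonneg _) (norm_nonneg _)).1 ?_
  have h2 : HasSum (fun α => ‖x α‖ ^ 2) (‖x‖ ^ 2) := by
    simpa using lp.hasSum_norm (p := 2) (by norm_num) x
  refine hasSum_le (fun α => ?_) (hasSum_sq_lp f) h2
  rw [← sq_abs]
  exact pow_le_pow_left₀ (abs_nonneg _) (h α) 2

theorem norm_rePart_le {A : Type*} (x : lp (fun _ : A => ℂ) 2) : ‖rePart x‖ ≤ ‖x‖ :=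
  norm_lp_le_of_le fun α => Complex.abs_re_le_norm (x α)

theorem norm_imPart_le {A : Type*} (x : lp (fun _ : A => ℂ) 2) : ‖imPart x‖ ≤ ‖x‖ :=
  norm_lp_le_of_le fun α => Complex.abs_im_le_norm (x α)

/-- The factor `2` comes from bounding the real and imaginary parts separately by `‖x‖`. -/
theorem norm_Phi_le {A : Type*} (s : Scheme A) {t : ℝ} (ht : 0 < t) (hr : ratio t < 1)
    (x : lp (fun _ : A => ℂ) 2) : ‖Phi s t x‖ ≤ 2 * K t * ‖x‖ := by
  have h1 := (norm_PhiReal_le s ht hr (rePart x)).trans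
    (mul_le_mul_of_nonneg_left (norm_rePart_le x) (K_nonneg ht hr))
  have h2 := (norm_PhiReal_le s ht hr (imPart x)).trans
    (mul_le_mul_of_nonneg_left (norm_imPart_le x) (K_nonneg ht hr))
  calc ‖Phi s t x‖ ≤ ‖PhiReal s t (rePart x)‖ + ‖Complex.I • PhiReal s t (imPart x)‖ :=
        norm_add_le _ _
    _ = ‖PhiReal s t (rePart x)‖ + ‖PhiReal s t (imPart x)‖ := by
        rw [norm_smul, Complex.norm_I, one_mul]
    _ ≤ _ := by linarith

/-! ### Continuity -/

/-- The passage from a block to the next iterate is real-linear; continuity and homogeneity of the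
blocks are thereby inherited by the iterates. -/
theorem iter_succ_eq_inner {A : Type*} (s : Scheme A) (t : ℝ) (x : lp (fun _ : A => ℝ) 2) (j : ℕ)
    (β : s.part (j + 1)) :
    iter s t x (j + 1) β
      = (inner ℂ (walshL2 ((s.tau j).symm β).1) (toL2 (block s t x j))).re := by
  rw [block_eq, hasSum_inner_walshL2 (hasSum_scaledQ _ _ _), Complex.ofReal_re, iter_succ_apply]

/-- Bessel's inequality for the characters indexed by `A_{j+1}` through `tau j`. -/
theorem norm_iter_succ_sub_le {A : Type*} (s : Scheme A) (t : ℝ) (x y : lp (fun _ : A => ℝ) 2)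
    (j : ℕ) : ‖iter s t x (j + 1) - iter s t y (j + 1)‖
      ≤ ‖toL2 (block s t x j) - toL2 (block s t y j)‖ := by
  refine (sq_le_sq₀ (norm_nonneg _) (norm_nonneg _)).1 ?_
  refine hasSum_le_of_sum_le (hasSum_sq_lp _) fun 𝒯 => ?_
  have ho : Orthonormal ℂ fun β : s.part (j + 1) => walshL2 ((s.tau j).symm β).1 :=
    (orthonormal_walshL2 A).comp _ (Subtype.val_injective.comp (s.tau j).symm.injective)
  refine le_trans (Finset.sum_le_sum fun β _ => ?_) (ho.sum_inner_products_le (s := 𝒯) _)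
  rw [lp.coeFn_sub, Pi.sub_apply, iter_succ_eq_inner, iter_succ_eq_inner, ← Complex.sub_re,
    ← inner_sub_right, ← sq_abs]
  exact pow_le_pow_left₀ (abs_nonneg _) (Complex.abs_re_le_norm _) 2

theorem continuous_iter {A : Type*} (s : Scheme A) {t : ℝ} (ht : 0 < t) (j : ℕ) :
    Continuous fun x => iter s t x j := by
  induction j with
  | zero =>
    refine (LipschitzWith.of_dist_le_mul (K := 1) fun x y => ?_).continuous
    rw [NNReal.coe_one, one_mul, dist_eq_norm, dist_eq_norm, ← norm_iter_zero s t (x - y)]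
    exact le_of_eq (congrArg norm (lp.ext (by rfl)))
  | succ j ih =>
    rw [continuous_iff_continuousAt]
    intro x
    have h : Continuous fun y => toL2 (block s t y j) :=
      (continuous_toL2_scaledQ (s.part j) ht).comp ih
    rw [ContinuousAt, tendsto_iff_norm_sub_tendsto_zero]
    exact squeeze_zero (fun _ => norm_nonneg _) (fun y => norm_iter_succ_sub_le s t y x j)
      (tendsto_iff_norm_sub_tendsto_zero.1 (h.tendsto x))

theorem hasSum_toL2_PhiReal {A : Type*} (s : Scheme A) {t : ℝ} (ht : 0 < t) (hr : ratio t < 1)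
    (x : lp (fun _ : A => ℝ) 2) :
    HasSum (fun j => Complex.I ^ j • toL2 (block s t x j)) (toL2 (PhiReal s t x)) := by
  have h := toL2.hasSum (summable_norm_block s ht hr x).of_norm.hasSum
  simp only [map_smul] at h
  exact h

theorem continuous_toL2_PhiReal {A : Type*} (s : Scheme A) {t : ℝ} (ht : 0 < t)
    (hr : ratio t < 1) : Continuous fun x => toL2 (PhiReal s t x) := by
  rw [continuous_iff_continuousAt]
  intro x
  simp_rw [← fun y => (hasSum_toL2_PhiReal s ht hr y).tsum_eq]
  refine tendsto_tsum_of_dominated_convergence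
    -- With `‖x‖ + 1` in place of `‖y‖`, one geometric series dominates for all `y` near `x`.
    (bound := fun j => t * Real.exp (1 / (2 * t ^ 2)) * (‖x‖ + 1) * ratio t ^ j)
    ((summable_geometric_of_lt_one (ratio_nonneg ht) hr).mul_left _) (fun j => ?_) ?_
  · exact ((continuous_const_smul (Complex.I ^ j)).comp ((continuous_toL2_scaledQ (s.part j) ht).comp
      (continuous_iter s ht j))).tendsto x
  · have hx : ∀ᶠ y : lp (fun _ : A => ℝ) 2 in nhds x, ‖y‖ < ‖x‖ + 1 :=
      continuous_norm.continuousAt.eventually_lt continuousAt_const (lt_add_one _)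
    filter_upwards [hx] with y hy j
    rw [← map_smul]
    refine (norm_toL2_le _).trans ((norm_I_pow_smul_block_le s ht y j).trans ?_)
    have := ratio_nonneg ht
    gcongr

theorem continuous_rePart {A : Type*} : Continuous (rePart (A := A)) := by
  refine (LipschitzWith.of_dist_le_mul (K := 1) fun x y => ?_).continuous
  rw [NNReal.coe_one, one_mul, dist_eq_norm, dist_eq_norm]
  exact (norm_rePart_le (x - y)).trans_eq' (congrArg norm (lp.ext (by rfl)))

theorem continuous_imPart {A : Type*} : Continuous (imPart (A := A)) := by
  refine (LipschitzWith.of_dist_le_mul (K := 1) fun x y => ?_).continuous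
  rw [NNReal.coe_one, one_mul, dist_eq_norm, dist_eq_norm]
  exact (norm_imPart_le (x - y)).trans_eq' (congrArg norm (lp.ext (by rfl)))

theorem continuous_toL2_Phi {A : Type*} (s : Scheme A) {t : ℝ} (ht : 0 < t)
    (hr : ratio t < 1) : Continuous fun x => toL2 (Phi s t x) := by
  simp only [Phi, map_add, map_smul]
  exact ((continuous_toL2_PhiReal s ht hr).comp continuous_rePart).add
    ((continuous_const_smul Complex.I).comp
      ((continuous_toL2_PhiReal s ht hr).comp continuous_imPart))

theorem tendsto_eLpNorm_Phi_sub {A : Type*} (s : Scheme A) {t : ℝ} (ht : 0 < t)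
    (hr : ratio t < 1) (x : lp (fun _ : A => ℂ) 2) :
    Filter.Tendsto (fun y => eLpNorm (⇑(Phi s t y) - ⇑(Phi s t x)) 2 (cubeMeasure A))
      (nhds x) (nhds 0) := by
  have h := (tendsto_iff_edist_tendsto_0.1 ((continuous_toL2_Phi s ht hr).tendsto x))
  refine h.congr fun y => ?_
  rw [Lp.edist_def]
  exact eLpNorm_congr_ae ((coeFn_toL2 _).sub (coeFn_toL2 _))

/-! ### The Parseval-like formula -/

/-- The bilinear form `(f, g) ↦ ∫ f g dℙ_A` on `L²(Ω_A, ℙ_A)`. -/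
noncomputable def pairing (A : Type*) :
    Lp ℂ 2 (cubeMeasure A) →L[ℂ] Lp ℂ 2 (cubeMeasure A) →L[ℂ] ℂ :=
  (ContinuousLinearMap.mul ℂ ℂ).lpPairing (cubeMeasure A) 2 2

theorem pairing_apply {A : Type*} (f g : Lp ℂ 2 (cubeMeasure A)) :
    pairing A f g = ∫ ω, f ω * g ω ∂cubeMeasure A := by
  rw [pairing, ContinuousLinearMap.lpPairing_eq_integral]
  rfl

theorem pairing_toL2 {A : Type*} (f g : Lp ℂ ∞ (cubeMeasure A)) :
    pairing A (toL2 f) (toL2 g) = ∫ ω, f ω * g ω ∂cubeMeasure A := by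
  rw [pairing_apply]
  exact integral_congr_ae ((coeFn_toL2 f).mul (coeFn_toL2 g))

/-- Walsh characters are real, so orthonormality serves the bilinear pairing as well as the
Hermitian one. -/
theorem pairing_walshL2 {A : Type*} (S : Finset A) (g : Lp ℂ 2 (cubeMeasure A)) :
    pairing A (walshL2 S) g = inner ℂ (walshL2 S) g := by
  rw [pairing_apply, inner_walshL2, walshCoeff]
  refine integral_congr_ae ?_
  filter_upwards [coeFn_walshL2 S] with ω hω
  rw [hω, mul_comm]

theorem hasSum_pairing {A : Type*} {a b : Finset A → ℂ} {f g : Lp ℂ 2 (cubeMeasure A)}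
    (hf : HasSum (fun S => a S • walshL2 S) f) (hg : HasSum (fun S => b S • walshL2 S) g) :
    HasSum (fun S => a S * b S) (pairing A f g) := by
  have h := ((pairing A).flip g).hasSum hf
  have e : (fun S => a S * b S) = fun S => (pairing A).flip g (a S • walshL2 S) := funext fun S => by
    rw [map_smul, ContinuousLinearMap.flip_apply, pairing_walshL2, hasSum_inner_walshL2 hg,
      smul_eq_mul]
  rw [e]
  exact h

/-- `Θ_j(x) = Θ_j(u) + i Θ_j(v)` for `x = u + i v`, as an element of `L²(Ω_A, ℙ_A)`. -/
noncomputable def complexBlock {A : Type*} (s : Scheme A) (t : ℝ) (x : lp (fun _ : A => ℂ) 2)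
    (j : ℕ) : Lp ℂ 2 (cubeMeasure A) :=
  toL2 (block s t (rePart x) j) + Complex.I • toL2 (block s t (imPart x) j)

/-- `x^{(j)} = u^{(j)} + i v^{(j)}` for `x = u + i v`. -/
noncomputable def complexIter {A : Type*} (s : Scheme A) (t : ℝ) (x : lp (fun _ : A => ℂ) 2)
    (j : ℕ) (β : s.part j) : ℂ :=
  (iter s t (rePart x) j β : ℂ) + Complex.I * (iter s t (imPart x) j β : ℂ)

theorem hasSum_toL2_Phi {A : Type*} (s : Scheme A) {t : ℝ} (ht : 0 < t) (hr : ratio t < 1)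
    (x : lp (fun _ : A => ℂ) 2) :
    HasSum (fun j => Complex.I ^ j • complexBlock s t x j) (toL2 (Phi s t x)) := by
  rw [Phi, map_add, map_smul]
  convert (hasSum_toL2_PhiReal s ht hr (rePart x)).add
    ((hasSum_toL2_PhiReal s ht hr (imPart x)).const_smul Complex.I) using 2 with j
  rw [complexBlock, smul_add, smul_comm Complex.I]

theorem blockCoeffReal_eq {A : Type*} (s : Scheme A) (t : ℝ) (x : lp (fun _ : A => ℝ) 2) (j : ℕ)
    (S : Finset A) : blockCoeffReal s t x j S
      = ((t * ‖iter s t x j‖ * qCoeff (s.part j) (sigma t (iter s t x j)) S : ℝ) : ℂ) := by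
  rw [blockCoeffReal, walshCoeff_Q, ← Complex.ofReal_mul]

theorem hasSum_complexBlock {A : Type*} (s : Scheme A) (t : ℝ) (x : lp (fun _ : A => ℂ) 2)
    (j : ℕ) : HasSum (fun S => blockCoeff s t x j S • walshL2 S) (complexBlock s t x j) := by
  rw [complexBlock, block_eq, block_eq]
  convert (hasSum_scaledQ _ t (iter s t (rePart x) j)).add
    ((hasSum_scaledQ _ t (iter s t (imPart x) j)).const_smul Complex.I) using 2 with S
  rw [smul_smul, ← add_smul, blockCoeff, blockCoeffReal_eq, blockCoeffReal_eq]

theorem blockCoeff_of_not_subset {A : Type*} (s : Scheme A) (t : ℝ) (x : lp (fun _ : A => ℂ) 2)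
    {j : ℕ} {S : Finset A} (h : ¬ (S : Set A) ⊆ s.part j) : blockCoeff s t x j S = 0 := by
  simp [blockCoeff, blockCoeffReal_eq, qCoeff_of_not_subset _ _ h]

theorem blockCoeff_of_even {A : Type*} (s : Scheme A) (t : ℝ) (x : lp (fun _ : A => ℂ) 2)
    {j : ℕ} {S : Finset A} (h : Even S.card) : blockCoeff s t x j S = 0 := by
  simp [blockCoeff, blockCoeffReal_eq, qCoeff_even _ _ h]

theorem mul_sigma_apply {F : Type*} {t : ℝ} (ht : 0 < t) (x : lp (fun _ : F => ℝ) 2) (α : F) :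
    t * ‖x‖ * sigma t x α = x α := by
  by_cases hx : x = 0
  · simp [hx]
  · have hx' : ‖x‖ ≠ 0 := norm_ne_zero_iff.2 hx
    rw [sigma_of_ne t hx, lp.coeFn_smul, Pi.smul_apply, smul_eq_mul]
    field_simp

/-- The prefactor `t‖·‖` cancels the normalization, and the imaginary part of `I ^ 1` is `1`. -/
theorem blockCoeff_singleton {A : Type*} (s : Scheme A) {t : ℝ} (ht : 0 < t)
    (x : lp (fun _ : A => ℂ) 2) (j : ℕ) (β : s.part j) :
    blockCoeff s t x j {β.1} = complexIter s t x j β := by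
  rw [blockCoeff, blockCoeffReal_eq, blockCoeffReal_eq, qCoeff_singleton, qCoeff_singleton,
    mul_sigma_apply ht, mul_sigma_apply ht, complexIter]

theorem blockCoeff_tau_symm {A : Type*} (s : Scheme A) (t : ℝ) (x : lp (fun _ : A => ℂ) 2)
    (j : ℕ) (β : s.part (j + 1)) :
    blockCoeff s t x j ((s.tau j).symm β).1 = complexIter s t x (j + 1) β := by
  rw [blockCoeff, blockCoeffReal_eq, blockCoeffReal_eq, complexIter, iter_succ_apply,
    iter_succ_apply]

/-- A set contained in two disjoint parts is empty, and the empty set has even order, where all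
coefficients vanish. -/
theorem pairing_complexBlock_of_ne {A : Type*} (s : Scheme A) (t : ℝ)
    (x y : lp (fun _ : A => ℂ) 2) {j k : ℕ} (h : j ≠ k) :
    pairing A (complexBlock s t x j) (complexBlock s t y k) = 0 := by
  refine (hasSum_pairing (hasSum_complexBlock s t x j) (hasSum_complexBlock s t y k)).unique ?_
  convert hasSum_zero with S
  by_cases hj : (S : Set A) ⊆ s.part j
  · by_cases hk : (S : Set A) ⊆ s.part k
    · have hS : (S : Set A) = ∅ := Set.subset_empty_iff.1 (s.disjoint h hj hk)
      rw [Finset.coe_eq_empty] at hS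
      rw [blockCoeff_of_even s t x (by simp [hS]), zero_mul]
    · rw [blockCoeff_of_not_subset s t y hk, mul_zero]
  · rw [blockCoeff_of_not_subset s t x hj, zero_mul]

theorem hasSum_pairing_complexBlock {A : Type*} (s : Scheme A) {t : ℝ} (ht : 0 < t)
    (hr : ratio t < 1) (x y : lp (fun _ : A => ℂ) 2) :
    HasSum (fun j : ℕ => (-1 : ℂ) ^ j * pairing A (complexBlock s t x j) (complexBlock s t y j))
      (∫ ω, Phi s t x ω * Phi s t y ω ∂cubeMeasure A) := by
  rw [← pairing_toL2]
  have h := ((pairing A).flip (toL2 (Phi s t y))).hasSum (hasSum_toL2_Phi s ht hr x)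
  have e : (fun j : ℕ => (-1 : ℂ) ^ j * pairing A (complexBlock s t x j) (complexBlock s t y j))
      = fun j => (pairing A).flip (toL2 (Phi s t y)) (Complex.I ^ j • complexBlock s t x j) :=
    funext fun j => by
      -- Of the expansion of `Phi s t y` only the term with index `j` survives, and `I ^ j * I ^ j =
      -- (-1) ^ j`.
      have h2 := (pairing A (complexBlock s t x j)).hasSum (hasSum_toL2_Phi s ht hr y)
      have h3 := h2.unique (hasSum_single j fun k hk => by
        rw [map_smul, pairing_complexBlock_of_ne s t x y hk.symm, smul_zero])
      rw [ContinuousLinearMap.flip_apply, map_smul, _root_.smul_apply, h3, map_smul,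
        smul_smul, ← pow_add, ← two_mul, pow_mul, Complex.I_sq, smul_eq_mul]
  rw [e]
  exact h

theorem hasSum_blockCoeff_subtype {A : Type*} (s : Scheme A) (t : ℝ)
    (x y : lp (fun _ : A => ℂ) 2) (j : ℕ) :
    HasSum (fun S : {S : Finset A // (S : Set A) ⊆ s.part j} =>
        blockCoeff s t x j S * blockCoeff s t y j S)
      (pairing A (complexBlock s t x j) (complexBlock s t y j)) := by
  refine (Subtype.val_injective.hasSum_iff
    (f := fun S => blockCoeff s t x j S * blockCoeff s t y j S) fun S hS => ?_).2
    (hasSum_pairing (hasSum_complexBlock s t x j) (hasSum_complexBlock s t y j))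
  have hS' : ¬ (S : Set A) ⊆ s.part j := fun h => hS ⟨⟨S, h⟩, rfl⟩
  rw [blockCoeff_of_not_subset s t x hS', zero_mul]

/-- The odd Walsh characters on `A_j`, indexed by `A_j` (order one) and `A_{j+1}` (order at least
three). -/
noncomputable def oddIndex {A : Type*} (s : Scheme A) (j : ℕ) :
    s.part j ⊕ s.part (j + 1) → Finset A :=
  Sum.elim (fun β => {β.1}) fun β => ((s.tau j).symm β).1

theorem oddIndex_injective {A : Type*} (s : Scheme A) (j : ℕ) :
    Function.Injective (oddIndex s j) := by
  refine Function.Injective.sumElim (Finset.singleton_injective.comp Subtype.val_injective)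
    (Subtype.val_injective.comp (s.tau j).symm.injective) fun β γ h => ?_
  refine (odd_card_of_mem_oddWalsh ((s.tau j).symm γ).2).2 ?_
  rw [← h, Finset.card_singleton]

theorem mem_range_oddIndex {A : Type*} (s : Scheme A) (j : ℕ) {S : Finset A}
    (h : (S : Set A) ⊆ s.part j) (ho : Odd S.card) : S ∈ Set.range (oddIndex s j) := by
  obtain ⟨k, hk⟩ := ho
  rcases Nat.eq_zero_or_pos k with rfl | hk'
  · obtain ⟨α, rfl⟩ := Finset.card_eq_one.1 hk
    exact ⟨Sum.inl ⟨α, h (by simp)⟩, rfl⟩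
  · refine ⟨Sum.inr (s.tau j ⟨S, h, k, hk', hk⟩), ?_⟩
    simp [oddIndex]

/-- The bilinear form `∑ x^{(j)} y^{(j)}`. -/
noncomputable def iterForm {A : Type*} (s : Scheme A) (t : ℝ) (x y : lp (fun _ : A => ℂ) 2)
    (j : ℕ) : ℂ :=
  ∑' β, complexIter s t x j β * complexIter s t y j β

theorem norm_complexIter_sq {A : Type*} (s : Scheme A) (t : ℝ) (x : lp (fun _ : A => ℂ) 2)
    (j : ℕ) (β : s.part j) : ‖complexIter s t x j β‖ ^ 2
      = iter s t (rePart x) j β ^ 2 + iter s t (imPart x) j β ^ 2 := by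
  rw [complexIter, Complex.sq_norm, Complex.normSq_apply]
  simp
  ring

theorem hasSum_norm_complexIter_sq {A : Type*} (s : Scheme A) (t : ℝ)
    (x : lp (fun _ : A => ℂ) 2) (j : ℕ) : HasSum (fun β => ‖complexIter s t x j β‖ ^ 2)
      (‖iter s t (rePart x) j‖ ^ 2 + ‖iter s t (imPart x) j‖ ^ 2) := by
  simp_rw [norm_complexIter_sq]
  exact (hasSum_sq_lp _).add (hasSum_sq_lp _)

theorem norm_complexIter_mul_le {A : Type*} (s : Scheme A) (t : ℝ) (x y : lp (fun _ : A => ℂ) 2)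
    (j : ℕ) (β : s.part j) : ‖complexIter s t x j β * complexIter s t y j β‖
      ≤ ‖complexIter s t x j β‖ ^ 2 + ‖complexIter s t y j β‖ ^ 2 := by
  rw [norm_mul]
  nlinarith [sq_nonneg (‖complexIter s t x j β‖ - ‖complexIter s t y j β‖),
    sq_nonneg (‖complexIter s t x j β‖), sq_nonneg (‖complexIter s t y j β‖)]

theorem hasSum_iterForm {A : Type*} (s : Scheme A) (t : ℝ) (x y : lp (fun _ : A => ℂ) 2)
    (j : ℕ) : HasSum (fun β => complexIter s t x j β * complexIter s t y j β)
      (iterForm s t x y j) :=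
  (Summable.of_norm_bounded ((hasSum_norm_complexIter_sq s t x j).add
    (hasSum_norm_complexIter_sq s t y j)).summable
    (norm_complexIter_mul_le s t x y j)).hasSum

theorem tendsto_iterForm {A : Type*} (s : Scheme A) {t : ℝ} (ht : 0 < t) (hr : ratio t < 1)
    (x y : lp (fun _ : A => ℂ) 2) :
    Filter.Tendsto (iterForm s t x y) Filter.atTop (nhds 0) := by
  have hiter : ∀ u : lp (fun _ : A => ℝ) 2,
      Filter.Tendsto (fun j => ‖iter s t u j‖) Filter.atTop (nhds 0) := fun u => by
    have h := (tendsto_pow_atTop_nhds_zero_of_lt_one (ratio_nonneg ht) hr).mul_const ‖u‖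
    rw [zero_mul] at h
    exact squeeze_zero (fun _ => norm_nonneg _) (norm_iter_le s ht u) h
  refine squeeze_zero_norm (fun j => tsum_of_norm_bounded
    ((hasSum_norm_complexIter_sq s t x j).add (hasSum_norm_complexIter_sq s t y j))
    (norm_complexIter_mul_le s t x y j)) ?_
  simpa using ((((hiter (rePart x)).pow 2).add ((hiter (imPart x)).pow 2)).add
    (((hiter (rePart y)).pow 2).add ((hiter (imPart y)).pow 2)))

/-- The characters seen by a block split into order one, which contributes the form at level `j`,
and odd order at least three, which `tau j` turns into the form at level `j + 1`. -/
theorem pairing_complexBlock_self {A : Type*} (s : Scheme A) {t : ℝ} (ht : 0 < t)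
    (x y : lp (fun _ : A => ℂ) 2) (j : ℕ) :
    pairing A (complexBlock s t x j) (complexBlock s t y j)
      = iterForm s t x y j + iterForm s t x y (j + 1) := by
  have h := ((oddIndex_injective s j).hasSum_iff
    (f := fun S => blockCoeff s t x j S * blockCoeff s t y j S) fun S hS => by
      by_cases h : (S : Set A) ⊆ s.part j
      · rw [blockCoeff_of_even s t x
          (Nat.not_odd_iff_even.1 fun ho => hS (mem_range_oddIndex s j h ho)), zero_mul]
      · rw [blockCoeff_of_not_subset s t x h, zero_mul]).2
    (hasSum_pairing (hasSum_complexBlock s t x j) (hasSum_complexBlock s t y j))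
  refine h.unique (HasSum.sum ?_ ?_)
  · convert hasSum_iterForm s t x y j using 2 with β
    simp [oddIndex, blockCoeff_singleton s ht]
  · convert hasSum_iterForm s t x y (j + 1) using 2 with β
    simp [oddIndex, blockCoeff_tau_symm]

theorem sum_range_alternating (D : ℕ → ℂ) (n : ℕ) :
    ∑ j ∈ Finset.range n, (-1 : ℂ) ^ j * (D j + D (j + 1)) = D 0 - (-1) ^ n * D n := by
  induction n with
  | zero => simp
  | succ n ih =>
    rw [Finset.sum_range_succ, ih]
    ring

/-- The alternating series of blocks telescopes, and its remainder `(-1) ^ n * iterForm s t x y n`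
tends to `0`. -/
theorem integral_Phi_mul_Phi {A : Type*} (s : Scheme A) {t : ℝ} (ht : 0 < t) (hr : ratio t < 1)
    (x y : lp (fun _ : A => ℂ) 2) :
    ∫ ω, Phi s t x ω * Phi s t y ω ∂cubeMeasure A = iterForm s t x y 0 := by
  have h1 := (hasSum_pairing_complexBlock s ht hr x y).tendsto_sum_nat
  simp_rw [pairing_complexBlock_self s ht, sum_range_alternating] at h1
  refine tendsto_nhds_unique h1 ?_
  have h2 : Filter.Tendsto (fun n => (-1 : ℂ) ^ n * iterForm s t x y n) Filter.atTop (nhds 0) := by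
    rw [tendsto_zero_iff_norm_tendsto_zero]
    simpa using (tendsto_iterForm s ht hr x y).norm
  simpa using h2.const_sub (iterForm s t x y 0)

theorem complexIter_zero {A : Type*} (s : Scheme A) (t : ℝ) (x : lp (fun _ : A => ℂ) 2) (α : A) :
    complexIter s t x 0 (s.tau0 α) = x α := by
  rw [complexIter, iter_zero_apply, iter_zero_apply, Equiv.symm_apply_apply, mul_comm]
  exact Complex.re_add_im (x α)

theorem hasSum_mul_eq_integral {A : Type*} (s : Scheme A) {t : ℝ} (ht : 0 < t) (hr : ratio t < 1)
    (x y : lp (fun _ : A => ℂ) 2) :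
    HasSum (fun α => x α * y α) (∫ ω, Phi s t x ω * Phi s t y ω ∂cubeMeasure A) := by
  rw [integral_Phi_mul_Phi s ht hr]
  convert s.tau0.hasSum_iff.2 (hasSum_iterForm s t x y 0) using 2 with α
  simp only [Function.comp, complexIter_zero]

/-! ### Homogeneity -/

theorem scaledQ_zero {A : Type*} (F : Set A) (t : ℝ) : scaledQ F t 0 = 0 := by
  rw [scaledQ, norm_zero, mul_zero, Complex.ofReal_zero, zero_smul]

theorem scaledQ_neg {A : Type*} (F : Set A) (t : ℝ) (x : lp (fun _ : F => ℝ) 2) :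
    scaledQ F t (-x) = -scaledQ F t x := by
  by_cases hx : x = 0
  · rw [hx, neg_zero, scaledQ_zero, neg_zero]
  · rw [scaledQ, scaledQ, sigma_of_ne t hx, sigma_of_ne t (neg_ne_zero.2 hx), norm_neg, smul_neg,
      Q_neg, smul_neg]

/-- Normalization sees only the direction of `x`, so positive scaling changes nothing but the
prefactor. Negative scalars need in addition that `Q` is odd. -/
theorem scaledQ_smul_of_pos {A : Type*} (F : Set A) (t : ℝ) {a : ℝ} (ha : 0 < a)
    (x : lp (fun _ : F => ℝ) 2) : scaledQ F t (a • x) = (a : ℂ) • scaledQ F t x := by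
  by_cases hx : x = 0
  · rw [hx, smul_zero, scaledQ_zero, smul_zero]
  · have h : (t * (a * ‖x‖))⁻¹ * a = (t * ‖x‖)⁻¹ := by
      rw [mul_left_comm, mul_inv, mul_right_comm, inv_mul_cancel₀ ha.ne', one_mul]
    rw [scaledQ, scaledQ, sigma_of_ne t hx, sigma_of_ne t (smul_ne_zero ha.ne' hx), norm_smul,
      Real.norm_eq_abs, abs_of_pos ha, smul_smul, smul_smul, h, ← Complex.ofReal_mul,
      mul_left_comm]

theorem scaledQ_smul {A : Type*} (F : Set A) (t a : ℝ) (x : lp (fun _ : F => ℝ) 2) :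
    scaledQ F t (a • x) = (a : ℂ) • scaledQ F t x := by
  rcases lt_trichotomy a 0 with ha | rfl | ha
  · have h := scaledQ_smul_of_pos F t (neg_pos.2 ha) x
    rw [neg_smul, scaledQ_neg, Complex.ofReal_neg, neg_smul, neg_inj] at h
    exact h
  · rw [zero_smul, scaledQ_zero, Complex.ofReal_zero, zero_smul]
  · exact scaledQ_smul_of_pos F t ha x

theorem iter_smul {A : Type*} (s : Scheme A) (t a : ℝ) (x : lp (fun _ : A => ℝ) 2) (j : ℕ) :
    iter s t (a • x) j = a • iter s t x j := by
  induction j with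
  | zero => rfl
  | succ j ih =>
    refine lp.ext (funext fun β => ?_)
    rw [lp.coeFn_smul, Pi.smul_apply, iter_succ_eq_inner, iter_succ_eq_inner, block_eq, ih,
      scaledQ_smul, map_smul, inner_smul_right, Complex.re_ofReal_mul, block_eq, smul_eq_mul]

theorem PhiReal_smul {A : Type*} (s : Scheme A) (t a : ℝ) (x : lp (fun _ : A => ℝ) 2) :
    PhiReal s t (a • x) = (a : ℂ) • PhiReal s t x := by
  -- Scalars from a field commute with `tsum` whether or not the series converges, so no condition
  -- on `t` is needed.
  rw [PhiReal, PhiReal, ← tsum_const_smul'']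
  refine tsum_congr fun j => ?_
  rw [block_eq, block_eq, iter_smul, scaledQ_smul, smul_comm]

theorem Phi_smul {A : Type*} (s : Scheme A) (t : ℝ) (ξ : ℂ) (x : lp (fun _ : A => ℂ) 2)
    (hx : ∀ α, (x α).im = 0) : Phi s t (ξ • x) = ξ • Phi s t x := by
  have h1 : rePart (ξ • x) = ξ.re • rePart x := lp.ext (funext fun α => by
    change (ξ * x α).re = ξ.re * (x α).re
    rw [Complex.mul_re, hx α, mul_zero, sub_zero])
  have h2 : imPart (ξ • x) = ξ.im • rePart x := lp.ext (funext fun α => by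
    change (ξ * x α).im = ξ.im * (x α).re
    rw [Complex.mul_im, hx α, mul_zero, zero_add])
  -- Written as a multiple of `rePart x` so that real homogeneity covers this term too.
  have h3 : imPart x = (0 : ℝ) • rePart x := lp.ext (funext fun α => by
    change (x α).im = 0 * (x α).re
    rw [hx α, zero_mul])
  rw [Phi, Phi, h1, h2, h3, PhiReal_smul, PhiReal_smul, PhiReal_smul, smul_smul, ← add_smul,
    Complex.ofReal_zero, zero_smul, smul_zero, add_zero, mul_comm, Complex.re_add_im]

/-! ### The threshold -/

theorem strictConvexOn_sinh : StrictConvexOn ℝ (Set.Ici 0) Real.sinh := by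
  refine strictConvexOn_of_deriv2_pos (convex_Ici 0) Real.continuous_sinh.continuousOn ?_
  intro x hx
  rw [interior_Ici] at hx
  simpa [Real.deriv_sinh, Real.deriv_cosh] using hx

/-- The quotient is the slope of the chord of `sinh` from the origin, which increases by strict
convexity. With `x = 1/c²` it is `thresholdFun c`. -/
theorem sinh_div_lt_sinh_div {x y : ℝ} (hx : 0 < x) (hxy : x < y) :
    Real.sinh x / x < Real.sinh y / y := by
  simpa using strictConvexOn_sinh.secant_strict_mono (a := 0) (x := x) (y := y) (by simp)
    hx.le (hx.trans hxy).le hx.ne' (hx.trans hxy).ne' hxy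

/-- The function `c² sinh(1/c²)`, whose value at the threshold is `2`. -/
noncomputable def thresholdFun (c : ℝ) : ℝ := c ^ 2 * Real.sinh (1 / c ^ 2)

theorem thresholdFun_lt {c d : ℝ} (hc : 0 < c) (hcd : c < d) :
    thresholdFun d < thresholdFun c := by
  have hd : 0 < d := hc.trans hcd
  have h := sinh_div_lt_sinh_div (x := 1 / d ^ 2) (y := 1 / c ^ 2) (by positivity)
    (one_div_lt_one_div_of_lt (by positivity) (pow_lt_pow_left₀ hcd hc.le two_ne_zero))
  rw [div_div_eq_mul_div, div_div_eq_mul_div, div_one, div_one] at h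
  rw [thresholdFun, thresholdFun]
  linarith

/-- All terms of the `sinh` series are positive here, so six of them give a lower bound. -/
theorem two_lt_thresholdFun : 2 < thresholdFun 0.67765 := by
  have h := sum_le_hasSum (Finset.range 6) (fun n _ => by positivity)
    (Real.hasSum_sinh (1 / 0.67765 ^ 2))
  rw [thresholdFun]
  simp only [Finset.sum_range_succ, Finset.sum_range_zero, Nat.factorial] at h
  norm_num at h ⊢
  linarith

/-- `Real.exp_bound'` needs an argument at most `1`, hence the division by `3` and the cube. The
rounded-up value `2.06614` bounds `exp` from above, and through its inverse also bounds the negative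
exponential in `sinh` from below. -/
theorem thresholdFun_lt_two : thresholdFun 0.67775 < 2 := by
  have h := Real.exp_bound' (x := 1 / 0.67775 ^ 2 / 3) (by positivity) (by norm_num) (n := 8)
    (by norm_num)
  simp only [Finset.sum_range_succ, Finset.sum_range_zero, Nat.factorial] at h
  have h2 : Real.exp (1 / 0.67775 ^ 2 / 3) ≤ 2.06614 := h.trans (by norm_num)
  have h3 : Real.exp (1 / 0.67775 ^ 2) ≤ 2.06614 ^ 3 := by
    calc Real.exp (1 / 0.67775 ^ 2) = Real.exp (1 / 0.67775 ^ 2 / 3) ^ 3 := by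
          rw [← Real.exp_nat_mul]
          congr 1
          push_cast
          ring
      _ ≤ _ := pow_le_pow_left₀ (Real.exp_pos _).le h2 3
  have h4 : (2.06614 ^ 3)⁻¹ ≤ Real.exp (-(1 / 0.67775 ^ 2)) := by
    rw [Real.exp_neg]
    exact inv_anti₀ (Real.exp_pos _) h3
  rw [thresholdFun, Real.sinh_eq]
  norm_num at h3 h4 ⊢
  linarith

theorem exists_threshold : ∃ c : ℝ, 0 < c ∧ |c - 0.6777| < 0.00005 ∧ thresholdFun c = 2 := by
  have hcont : ContinuousOn thresholdFun (Set.Icc 0.67765 0.67775) := by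
    intro c hc
    have hc0 : c ^ 2 ≠ 0 := pow_ne_zero 2 (lt_of_lt_of_le (by norm_num) hc.1).ne'
    have h : ContinuousAt (fun c : ℝ => 1 / c ^ 2) c :=
      ContinuousAt.div continuousAt_const (by fun_prop) hc0
    have h2 : ContinuousAt (fun c : ℝ => c ^ 2 * Real.sinh (1 / c ^ 2)) c :=
      ContinuousAt.mul (by fun_prop)
        (ContinuousAt.comp (f := fun c : ℝ => 1 / c ^ 2) Real.continuous_sinh.continuousAt h)
    exact h2.continuousWithinAt
  obtain ⟨c, hc, h⟩ := intermediate_value_Ioo' (by norm_num) hcont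
    ⟨thresholdFun_lt_two, two_lt_thresholdFun⟩
  refine ⟨c, lt_trans (by norm_num) hc.1, ?_, h⟩
  rw [abs_lt]
  constructor <;> norm_num <;> linarith [hc.1, hc.2]

theorem threshold_unique {c d : ℝ} (hc : 0 < c) (hd : 0 < d)
    (h : thresholdFun c = thresholdFun d) : c = d := by
  rcases lt_trichotomy c d with hcd | hcd | hcd
  · exact absurd h (thresholdFun_lt hc hcd).ne'
  · exact hcd
  · exact absurd h (thresholdFun_lt hd hcd).ne

/-- The square of the ratio is `thresholdFun t - 1`; this is where the number `2` in the definition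
of `c` comes from. -/
theorem ratio_lt_one {t : ℝ} (ht : 0 < t) (h : thresholdFun t < 2) : ratio t < 1 := by
  have hφ : 0 ≤ Real.sinh (1 / t ^ 2) - 1 / t ^ 2 :=
    sub_nonneg.2 (Real.self_le_sinh_iff.2 (by positivity))
  refine (sq_lt_sq₀ (ratio_nonneg ht) zero_le_one).1 ?_
  have h1 : t ^ 2 * (1 / t ^ 2) = 1 := by field_simp
  rw [ratio, mul_pow, Real.sq_sqrt hφ, mul_sub, h1]
  rw [thresholdFun] at h
  linarith

/-! ### Existence of the data -/

theorem nonempty_equiv_prod_nat (A : Type*) [Infinite A] : Nonempty (A ≃ A × ℕ) := by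
  refine Cardinal.eq.1 ?_
  rw [Cardinal.mk_prod, Cardinal.lift_uzero, Cardinal.mk_nat, Cardinal.lift_aleph0,
    Cardinal.mul_aleph0_eq (Cardinal.aleph0_le_mk A)]

/-- The upper bound counts finite subsets of `A`. For the lower bound, `F ≃ F × ℕ` splits `F` into
disjoint countable columns indexed by `F`, and each column supplies a set of order three. -/
theorem mk_oddWalsh {A : Type*} [Infinite A] (F : Set A)
    (hF : Cardinal.mk F = Cardinal.mk A) : Cardinal.mk (oddWalsh F) = Cardinal.mk A := by
  classical
  apply le_antisymm
  · exact (Cardinal.mk_set_le _).trans (Cardinal.mk_finset_of_infinite A).le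
  · have : Infinite F := Cardinal.infinite_iff.2 (hF ▸ Cardinal.aleph0_le_mk A)
    obtain ⟨e⟩ := nonempty_equiv_prod_nat F
    let f : F → Finset A := fun β => (Finset.range 3).image fun n => (e.symm (β, n)).1
    have hinj : ∀ β, Function.Injective fun n : ℕ => ((e.symm (β, n)).1 : A) := fun β m n h => by
      simpa using e.symm.injective (Subtype.val_injective h)
    have hf : ∀ β, f β ∈ oddWalsh F := fun β => by
      refine ⟨fun α hα => ?_, 1, le_rfl, ?_⟩
      · obtain ⟨n, -, rfl⟩ := Finset.mem_image.1 (Finset.mem_coe.1 hα)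
        exact (e.symm (β, n)).2
      · rw [Finset.card_image_of_injective _ (hinj β), Finset.card_range]
    rw [← hF]
    refine Cardinal.mk_le_of_injective (f := fun β => (⟨f β, hf β⟩ : oddWalsh F)) fun β γ h => ?_
    -- Columns are disjoint, so one common point forces `β = γ`.
    have hβ : ((e.symm (β, 0)).1 : A) ∈ f γ := by
      rw [← show f β = f γ from congrArg Subtype.val h]
      exact Finset.mem_image_of_mem (fun n => ((e.symm (β, n)).1 : A)) (by simp)
    obtain ⟨n, -, hn⟩ := Finset.mem_image.1 hβ
    exact (congrArg Prod.fst (e.symm.injective (Subtype.val_injective hn))).symm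

theorem nonempty_scheme (A : Type*) [Infinite A] : Nonempty (Scheme A) := by
  obtain ⟨e⟩ := nonempty_equiv_prod_nat A
  let part : ℕ → Set A := fun j => {a | (e a).2 = j}
  have hpart : ∀ j, Cardinal.mk (part j) = Cardinal.mk A := fun j => by
    refine le_antisymm (Cardinal.mk_set_le _) ?_
    refine Cardinal.mk_le_of_injective
      (f := fun a => (⟨e.symm (a, j), by simp [part]⟩ : part j)) fun a b h => ?_
    simpa using congrArg Subtype.val h
  have h0 : Nonempty (A ≃ part 0) := Cardinal.eq.1 (hpart 0).symm
  have h1 : ∀ j, Nonempty (oddWalsh (part j) ≃ part (j + 1)) := fun j =>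
    Cardinal.eq.1 ((mk_oddWalsh _ (hpart j)).trans (hpart (j + 1)).symm)
  exact ⟨{
    part := part
    disjoint := fun i j hij => Set.disjoint_left.2 fun a hi hj => hij (hi.symm.trans hj)
    iUnion_part := Set.eq_univ_of_forall fun a => Set.mem_iUnion.2 ⟨(e a).2, rfl⟩
    mk_part := hpart
    tau0 := h0.some
    tau := fun j => (h1 j).some }⟩

end WalshParseval

/-- Unconditional and absolute summability agree in `ℂ`, so `HasSum` and `Summable` express absolute
convergence of the scalar sums; in `L^∞` the norms are summed explicitly. Parts are numbered from
`0`, so the exponents `j - 1` become `j`. -/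
theorem mainTheorem6 {A : Type*} [Infinite A] :
    -- the threshold `c` exists, is unique, and `c ≈ 0.6777`
    (∃! c : ℝ, 0 < c ∧ 2 - c ^ 2 * Real.sinh (1 / c ^ 2) = 0) ∧
    -- the data used in the construction exist
    Nonempty (WalshParseval.Scheme A) ∧
    ∀ c : ℝ, 0 < c → 2 - c ^ 2 * Real.sinh (1 / c ^ 2) = 0 →
      |c - 0.6777| < 0.00005 ∧
      ∀ s : WalshParseval.Scheme A,
        (∀ t : ℝ, c < t →
          -- the series that defines `Φ₂` on real vectors converges absolutely in `L^∞`
          (∀ u : lp (fun _ : A => ℝ) 2,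
            Summable fun j : ℕ => ‖Complex.I ^ j • WalshParseval.block s t u j‖) ∧
          -- the norm bound
          (∀ x : lp (fun _ : A => ℂ) 2,
            ‖WalshParseval.Phi s t x‖ ≤ 2 * WalshParseval.K t * ‖x‖) ∧
          -- continuity from `l²` to `L²`
          (∀ x : lp (fun _ : A => ℂ) 2,
            Filter.Tendsto
              (fun y => eLpNorm (⇑(WalshParseval.Phi s t y) - ⇑(WalshParseval.Phi s t x)) 2
                (WalshParseval.cubeMeasure A))
              (nhds x) (nhds 0)) ∧
          -- the Parseval-like formula
          (∀ x y : lp (fun _ : A => ℂ) 2,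
            HasSum (fun α : A => x α * y α)
              (∫ ω, WalshParseval.Phi s t x ω * WalshParseval.Phi s t y ω
                ∂WalshParseval.cubeMeasure A) ∧
            (∀ j : ℕ, Summable fun S : {S : Finset A // (S : Set A) ⊆ s.part j} =>
              WalshParseval.blockCoeff s t x j S * WalshParseval.blockCoeff s t y j S) ∧
            HasSum (fun j : ℕ => (-1 : ℂ) ^ j *
                ∑' S : {S : Finset A // (S : Set A) ⊆ s.part j},
                  WalshParseval.blockCoeff s t x j S * WalshParseval.blockCoeff s t y j S)
              (∫ ω, WalshParseval.Phi s t x ω * WalshParseval.Phi s t y ω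
                ∂WalshParseval.cubeMeasure A))) ∧
        -- homogeneity for `t = 1` on real vectors
        ∀ (ξ : ℂ) (x : lp (fun _ : A => ℂ) 2), (∀ α, (x α).im = 0) →
          WalshParseval.Phi s 1 (ξ • x) = ξ • WalshParseval.Phi s 1 x := by
  obtain ⟨c₀, hc₀, hnear, heq⟩ := WalshParseval.exists_threshold
  have huniq : ∀ c : ℝ, 0 < c → 2 - c ^ 2 * Real.sinh (1 / c ^ 2) = 0 → c = c₀ := fun c hc h =>
    WalshParseval.threshold_unique hc hc₀ ((sub_eq_zero.1 h).symm.trans heq.symm)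
  refine ⟨⟨c₀, ⟨hc₀, sub_eq_zero.2 heq.symm⟩, fun c hc => huniq c hc.1 hc.2⟩,
    WalshParseval.nonempty_scheme A, fun c hc h => ?_⟩
  obtain rfl := huniq c hc h
  refine ⟨hnear, fun s => ⟨fun t hct => ?_, WalshParseval.Phi_smul s 1⟩⟩
  have ht : 0 < t := hc.trans hct
  have hr : WalshParseval.ratio t < 1 := WalshParseval.ratio_lt_one ht
    ((WalshParseval.thresholdFun_lt hc hct).trans_eq heq)
  refine ⟨WalshParseval.summable_norm_block s ht hr, WalshParseval.norm_Phi_le s ht hr,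
    WalshParseval.tendsto_eLpNorm_Phi_sub s ht hr, fun x y =>
      ⟨WalshParseval.hasSum_mul_eq_integral s ht hr x y,
        fun j => (WalshParseval.hasSum_blockCoeff_subtype s t x y j).summable, ?_⟩⟩
  simp_rw [fun j => (WalshParseval.hasSum_blockCoeff_subtype s t x y j).tsum_eq]
  exact WalshParseval.hasSum_pairing_complexBlock s ht hr x y
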